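/- **Theorem (Stiffness matrix).** Let $\Omega_0=\{r<1\}$ be the unit disk and $\Omega_\rho=\{\rho<r<1\}$ an annulus, $0<\rho<1$, in the plane with polar coordinates $(r,\theta)$; put $t=(1-\rho^2)^{-1}$, $\pi_0=2\pi$ and $\pi_m=\pi$ for $m\ge 1$, and $$p_{(a,b)}=\int_{-1}^1(1-x)^a(1+x)^b\,dx,\qquad q_{t,(a,b,c)}=\int_0^1x^a(1-x)^b(t-x)^c\,dx .$$ Let $P^{(a,b)}_n$ be the orthonormal polynomials on $(-1,1)$ for the weight $(1-x)^a(1+x)^b$, with positive leading coefficients, and $Q^{t,(a,b,c)}_n$ the orthonormal polynomials on $(0,1)$ for the weight $x^a(1-x)^b(t-x)^c$, with leading coefficients of sign $(-1)^n$. The Fourier modes are the pairs $(m,j)$ with $m\in\mathbb N_0$, $j\in\{0,1\}$, and $j=1$ if $m=0$. For $n=m,m+2,m+4,\dots$ put $Y_{m,1}=r^m\cos m\theta$, $Y_{m,0}=r^m\sin m\theta$, $$Z^{(a)}_{n,m,j}=Y_{m,j}\,P^{(a,m)}_{(n-m)/2}(2r^2-1),\qquad Z^{\rho,(a,b)}_{n,m,j}=Y_{m,j}\,Q^{t,(a,b,m)}_{(n-m)/2}\!\left(\tfrac{1-r^2}{1-\rho^2}\right),$$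 and let $\mathbf Z^{(a)}_{m,j}$, $\mathbf Z^{\rho,(a,b)}_{m,j}$ be the row vectors of these functions over $n=m,m+2,\dots$. Put $$\Phi^{\Omega_0}_{m,j}=\big(Z^{(0)}_{m,m,j}\;\;(1-r^2)\mathbf Z^{(1)}_{m,j}\big),$$ $$\Phi^{\Omega_\rho}_{m,j}=\big((1-r^2)Z^{\rho,(1,0)}_{m,m,j}\;\;(r^2-\rho^2)Z^{\rho,(0,1)}_{m,m,j}\;\;(1-r^2)(r^2-\rho^2)\mathbf Z^{\rho,(1,1)}_{m,j}\big),$$ and let $\Phi^{\Omega}$ be the concatenation of the $\Phi^{\Omega}_{m,j}$ over the modes $(0,1),(1,0),(1,1),(2,0),\dots$, for $\Omega=\Omega_0$ and $\Omega=\Omega_\rho$. For every $m$ there are unique column-finite matrices $D_m$ and $D_m^\rho$ such that, for all admissible $j$, $$\Delta\big[(1-r^2)\mathbf Z^{(1)}_{m,j}\big]=\mathbf Z^{(1)}_{m,j}D_m \text{ on }\Omega_0,\qquad \Delta\big[(1-r^2)(r^2-\rho^2)\mathbf Z^{\rho,(1,1)}_{m,j}\big]=\mathbf Z^{\rho,(1,1)}_{m,j}D_m^\rho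 \text{ on }\Omega_\rho;$$ $D_m$ is diagonal and $D^\rho_m$ is tridiagonal. For $\Omega\in\{\Omega_0,\Omega_\rho\}$ let $A^\Omega$ and $A^\Omega_{m,j}$ be the stiffness matrices $\langle(\nabla\Phi)^\top,\nabla\Phi\rangle_{L^2(\Omega)}$ of $\Phi=\Phi^\Omega$ and of $\Phi=\Phi^\Omega_{m,j}$. All the integrals that define their entries converge absolutely, and $A^\Omega$ is block diagonal with the blocks $A^\Omega_{m,j}$. Moreover $$A^{\Omega_0}_{m,j}=\begin{pmatrix}\dfrac{m\pi}{p_{(0,m)}}&0\\[1ex]0&-\dfrac{\pi_m}{2^{m+3}}D_m\end{pmatrix},$$ and $A^{\Omega_\rho}_{m,j}$ is the symmetric matrix whose first row is $(a_m,b_m,d_m,0,0,\dots)$, whose second row is $(b_m,c_m,e_m,0,0,\dots)$, and whose block of the rows and columns from the third on is $-\dfrac{\pi_m}{2t^{m+3}}D^\rho_m$, where $$a_m=\pi_m\frac{2-\rho^{2m}\big(m(2+m)-2m(2+m)\rho^2+(2+m(2+m))\rho^4\big)}{(2+m)\,q_{t,(1,0,m)}},$$ $$b_m=-\frac{2\pi_m(1-\rho^{4+2m})}{(2+m)\,q_{t,(1,0,m)}^{1/2}q_{t,(0,1,m)}^{1/2}},\qquad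 c_m=\pi_m\frac{2-2\rho^{4+2m}+m(2+m)t^{-2}}{(2+m)\,q_{t,(0,1,m)}},$$ $$d_m=2\pi_m(m+1)\,q_{t,(1,1,m)}^{1/2}q_{t,(1,0,m)}^{-1/2}t^{-(m+3)},\qquad e_m=-2\pi_m(m+1)\,q_{t,(1,1,m)}^{1/2}q_{t,(0,1,m)}^{-1/2}t^{-(m+3)}.$$ In particular $A^{\Omega}_{m,0}=A^{\Omega}_{m,1}$ for every $m\ge 1$. -/

import Mathlib

/-! The plane `ℝ²` is Mathlib's Euclidean plane `ℂ`, with `z = x + i y`: then `‖z‖` is `r`,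
`Complex.arg z` is `θ`, `volume` is Lebesgue measure `dx dy`, and `gradient`, `Laplacian.laplacian`,
`inner ℝ` are the usual real gradient, Laplacian and dot product of the plane. -/

noncomputable section

open MeasureTheory Polynomial

/-! ### Orthonormal polynomials in one variable -/

/-- The `n`-th monic orthogonal polynomial on `(lo, hi)` for the weight `w`
(Gram--Schmidt applied to `1, X, X ^ 2, …`). -/
def monicOrthoPoly (lo hi : ℝ) (w : ℝ → ℝ) (n : ℕ) : ℝ[X] :=
  X ^ n - ∑ k : Fin n,
    C ((∫ x in lo..hi, x ^ n * (monicOrthoPoly lo hi w k).eval x * w x) /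
        ∫ x in lo..hi, (monicOrthoPoly lo hi w k).eval x ^ 2 * w x) *
      monicOrthoPoly lo hi w k
  termination_by n
  decreasing_by all_goals exact k.2

/-- The `n`-th orthonormal polynomial on `(lo, hi)` for the weight `w`, with positive leading
coefficient. -/
def orthonormalPoly (lo hi : ℝ) (w : ℝ → ℝ) (n : ℕ) : ℝ[X] :=
  C (Real.sqrt (∫ x in lo..hi, (monicOrthoPoly lo hi w n).eval x ^ 2 * w x))⁻¹ *
    monicOrthoPoly lo hi w n

/-- The Jacobi weight `(1 - x) ^ a (1 + x) ^ b` on `(-1, 1)`. -/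
def jacobiWeight (a b x : ℝ) : ℝ := (1 - x) ^ a * (1 + x) ^ b

/-- The semiclassical Jacobi weight `x ^ a (1 - x) ^ b (t - x) ^ c` on `(0, 1)`. -/
def semiJacobiWeight (t a b c x : ℝ) : ℝ := x ^ a * (1 - x) ^ b * (t - x) ^ c

/-- The orthonormal Jacobi polynomial `P_n^{(a,b)}`. -/
def jacobiP (a b : ℝ) (n : ℕ) : ℝ[X] := orthonormalPoly (-1) 1 (jacobiWeight a b) n

/-- The orthonormal semiclassical Jacobi polynomial `Q_n^{t,(a,b,c)}`. Its leading coefficient has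
the sign `(-1) ^ n`, so that for `c = 0` it is a positive multiple of `P_n^{(a,b)}(1 - 2x)`. -/
def semiJacobiQ (t a b c : ℝ) (n : ℕ) : ℝ[X] :=
  C ((-1) ^ n) * orthonormalPoly 0 1 (semiJacobiWeight t a b c) n

/-- The normalisation constant `p_{(a,b)}`. -/
def jacobiNorm (a b : ℝ) : ℝ := ∫ x in (-1 : ℝ)..1, jacobiWeight a b x

/-- The normalisation constant `q_{t,(a,b,c)}`. -/
def semiJacobiNorm (t a b c : ℝ) : ℝ := ∫ x in (0 : ℝ)..1, semiJacobiWeight t a b c x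

/-! ### Domains and (annular) Zernike polynomials -/

/-- The unit disk `Ω_0`. -/
def unitDisk : Set ℂ := {z | ‖z‖ < 1}

/-- The annulus `Ω_ρ`. -/
def annulus (ρ : ℝ) : Set ℂ := {z | ρ < ‖z‖ ∧ ‖z‖ < 1}

/-- The Fourier mode `m` occurs with the sign `j`: if `m = 0` then `j = 1`. -/
def IsFourierMode (m : ℕ) (j : Fin 2) : Prop := m = 0 → j = 1

/-- The Fourier modes `(0,1), (1,0), (1,1), (2,0), …`. -/
abbrev FourierMode : Type := {p : ℕ × Fin 2 // IsFourierMode p.1 p.2}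

/-- The harmonic polynomial `Y_{m,j}`: `r ^ m cos (m θ)` for `j = 1`, `r ^ m sin (m θ)` for
`j = 0`. -/
def harmonicY (m : ℕ) (j : Fin 2) (z : ℂ) : ℝ :=
  ‖z‖ ^ m * (if j = 1 then Real.cos (m * Complex.arg z) else Real.sin (m * Complex.arg z))

theorem harmonicY_eq (m : ℕ) (j : Fin 2) (z : ℂ) :
    harmonicY m j z = if j = 1 then (z ^ m).re else (z ^ m).im := by
  have h : z ^ m = ((‖z‖ ^ m : ℝ) : ℂ) *
      (((Real.cos (m * Complex.arg z) : ℝ) : ℂ) +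
        ((Real.sin (m * Complex.arg z) : ℝ) : ℂ) * Complex.I) := by
    conv_lhs => rw [← Complex.norm_mul_exp_arg_mul_I z]
    rw [mul_pow, ← Complex.exp_nat_mul, ← mul_assoc]
    have h2 : ((m : ℂ) * (Complex.arg z : ℂ)) = ((m * Complex.arg z : ℝ) : ℂ) := by push_cast; rfl
    rw [h2, Complex.exp_mul_I]
    push_cast
    rfl
  rw [h, Complex.re_ofReal_mul, Complex.im_ofReal_mul]
  unfold harmonicY
  split_ifs <;>
    simp only [Complex.add_re, Complex.add_im, Complex.ofReal_re, Complex.ofReal_im,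
      Complex.mul_re, Complex.mul_im, Complex.I_re, Complex.I_im, mul_zero, mul_one,
      sub_zero, add_zero, zero_add]

/-- The generalised Zernike polynomial `Z^{(a)}_{n,m,j}`. -/
def zernike (a : ℝ) (n m : ℕ) (j : Fin 2) (z : ℂ) : ℝ :=
  harmonicY m j z * (jacobiP a m ((n - m) / 2)).eval (2 * ‖z‖ ^ 2 - 1)

/-- The parameter `t = (1 - ρ²)⁻¹`. -/
def annulusT (ρ : ℝ) : ℝ := (1 - ρ ^ 2)⁻¹

/-- The generalised Zernike annular polynomial `Z^{ρ,(a,b)}_{n,m,j}`. -/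
def zernikeAnnular (ρ a b : ℝ) (n m : ℕ) (j : Fin 2) (z : ℂ) : ℝ :=
  harmonicY m j z *
    (semiJacobiQ (annulusT ρ) a b m ((n - m) / 2)).eval ((1 - ‖z‖ ^ 2) / (1 - ρ ^ 2))

/-! ### Hat and bubble functions, and the hierarchical bases -/

/-- The bubble function `B_{n,m,j}` of the disk. -/
def diskBubble (n m : ℕ) (j : Fin 2) (z : ℂ) : ℝ :=
  (1 - ‖z‖ ^ 2) * zernike 1 n m j z

/-- The bubble function `B_{n,m,j}` of the annulus. -/
def annulusBubble (ρ : ℝ) (n m : ℕ) (j : Fin 2) (z : ℂ) : ℝ :=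
  (1 - ‖z‖ ^ 2) * (‖z‖ ^ 2 - ρ ^ 2) * zernikeAnnular ρ 1 1 n m j z

/-- The basis of the disk for the mode `(m, j)`: the hat function, then the bubble functions of
degree `m, m + 2, m + 4, …`. -/
def diskBasis (m : ℕ) (j : Fin 2) : ℕ → ℂ → ℝ
  | 0 => zernike 0 m m j
  | k + 1 => diskBubble (m + 2 * k) m j

/-- The basis of the annulus for the mode `(m, j)`: the hat function that vanishes on the outer
circle, the hat function that vanishes on the inner circle, then the bubble functions of degree
`m, m + 2, m + 4, …`. -/
def annulusBasis (ρ : ℝ) (m : ℕ) (j : Fin 2) : ℕ → ℂ → ℝ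
  | 0 => fun z => (1 - ‖z‖ ^ 2) * zernikeAnnular ρ 1 0 m m j z
  | 1 => fun z => (‖z‖ ^ 2 - ρ ^ 2) * zernikeAnnular ρ 0 1 m m j z
  | k + 2 => annulusBubble ρ (m + 2 * k) m j

/-- The full basis of the disk; the index `(k, (m, j))` is the `k`-th function of mode `(m, j)`. -/
def diskFullBasis (p : ℕ × FourierMode) : ℂ → ℝ := diskBasis p.2.1.1 p.2.1.2 p.1

/-- The full basis of the annulus. -/
def annulusFullBasis (ρ : ℝ) (p : ℕ × FourierMode) : ℂ → ℝ :=
  annulusBasis ρ p.2.1.1 p.2.1.2 p.1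

/-- The stiffness matrix `⟨(∇Φ)ᵀ, ∇Φ⟩_{L²(Ω)}` of a family `Φ` of functions. -/
def stiffnessMatrix {ι : Type*} (Ω : Set ℂ) (Φ : ι → ℂ → ℝ) : Matrix ι ι ℝ :=
  Matrix.of fun p q => ∫ z in Ω, inner ℝ (gradient (Φ p) z) (gradient (Φ q) z)

/-- All the integrals in the definition of the stiffness matrix converge absolutely. -/
def StiffnessIntegrable {ι : Type*} (Ω : Set ℂ) (Φ : ι → ℂ → ℝ) : Prop :=
  ∀ p q, IntegrableOn (fun z => inner ℝ (gradient (Φ p) z) (gradient (Φ q) z)) Ω volume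

/-! ### Laplacian matrices -/

/-- `D` is the Laplacian matrix `D_m`: its columns are finite and, for both signs `j`,
`Δ[(1 - r²) 𝐙^{(1)}_{m,j}] = 𝐙^{(1)}_{m,j} D` on the disk. -/
def IsDiskLaplacianMatrix (m : ℕ) (D : Matrix ℕ ℕ ℝ) : Prop :=
  (∀ k, {i | D i k ≠ 0}.Finite) ∧
    ∀ j, IsFourierMode m j → ∀ k, ∀ z ∈ unitDisk,
      Laplacian.laplacian (diskBubble (m + 2 * k) m j) z =
        ∑ᶠ i, zernike 1 (m + 2 * i) m j z * D i k

/-- `D` is the Laplacian matrix `D^ρ_m`: its columns are finite and, for both signs `j`,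
`Δ[(1 - r²) (r² - ρ²) 𝐙^{ρ,(1,1)}_{m,j}] = 𝐙^{ρ,(1,1)}_{m,j} D` on the annulus. -/
def IsAnnulusLaplacianMatrix (ρ : ℝ) (m : ℕ) (D : Matrix ℕ ℕ ℝ) : Prop :=
  (∀ k, {i | D i k ≠ 0}.Finite) ∧
    ∀ j, IsFourierMode m j → ∀ k, ∀ z ∈ annulus ρ,
      Laplacian.laplacian (annulusBubble ρ (m + 2 * k) m j) z =
        ∑ᶠ i, zernikeAnnular ρ 1 1 (m + 2 * i) m j z * D i k

/-- Only the diagonal and the two neighbouring diagonals are nonzero. -/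
def IsTridiagonal (D : Matrix ℕ ℕ ℝ) : Prop := ∀ i k, i + 1 < k ∨ k + 1 < i → D i k = 0

/-! ### The explicit blocks -/

/-- `π_0 = 2π` and `π_m = π` for `m ≥ 1`. -/
def fourierPi (m : ℕ) : ℝ := if m = 0 then 2 * Real.pi else Real.pi

/-- The block of the disk, in terms of `D = D_m`. -/
def diskBlock (m : ℕ) (D : Matrix ℕ ℕ ℝ) : Matrix ℕ ℕ ℝ
  | 0, 0 => m * Real.pi / jacobiNorm 0 m
  | 0, _ + 1 => 0
  | _ + 1, 0 => 0
  | i + 1, k + 1 => -(fourierPi m / 2 ^ (m + 3)) * D i k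

def coeffA (ρ : ℝ) (m : ℕ) : ℝ :=
  fourierPi m *
    (2 - ρ ^ (2 * m) * (m * (2 + m) - 2 * m * (2 + m) * ρ ^ 2 + (2 + m * (2 + m)) * ρ ^ 4)) /
      ((2 + m) * semiJacobiNorm (annulusT ρ) 1 0 m)

def coeffB (ρ : ℝ) (m : ℕ) : ℝ :=
  -(2 * fourierPi m * (1 - ρ ^ (4 + 2 * m))) /
    ((2 + m) * Real.sqrt (semiJacobiNorm (annulusT ρ) 1 0 m) *
      Real.sqrt (semiJacobiNorm (annulusT ρ) 0 1 m))

def coeffC (ρ : ℝ) (m : ℕ) : ℝ :=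
  fourierPi m * (2 - 2 * ρ ^ (4 + 2 * m) + m * (2 + m) / annulusT ρ ^ 2) /
    ((2 + m) * semiJacobiNorm (annulusT ρ) 0 1 m)

def coeffD (ρ : ℝ) (m : ℕ) : ℝ :=
  2 * fourierPi m * (m + 1) * Real.sqrt (semiJacobiNorm (annulusT ρ) 1 1 m) /
    (Real.sqrt (semiJacobiNorm (annulusT ρ) 1 0 m) * annulusT ρ ^ (m + 3))

def coeffE (ρ : ℝ) (m : ℕ) : ℝ :=
  -(2 * fourierPi m * (m + 1) * Real.sqrt (semiJacobiNorm (annulusT ρ) 1 1 m)) /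
    (Real.sqrt (semiJacobiNorm (annulusT ρ) 0 1 m) * annulusT ρ ^ (m + 3))

/-- The block of the annulus, in terms of `D = D^ρ_m`. -/
def annulusBlock (ρ : ℝ) (m : ℕ) (D : Matrix ℕ ℕ ℝ) : Matrix ℕ ℕ ℝ
  | 0, 0 => coeffA ρ m
  | 0, 1 => coeffB ρ m
  | 1, 0 => coeffB ρ m
  | 1, 1 => coeffC ρ m
  | 0, 2 => coeffD ρ m
  | 2, 0 => coeffD ρ m
  | 1, 2 => coeffE ρ m
  | 2, 1 => coeffE ρ m
  | 0, _ + 3 => 0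
  | 1, _ + 3 => 0
  | _ + 3, 0 => 0
  | _ + 3, 1 => 0
  | i + 2, k + 2 => -(fourierPi m / (2 * annulusT ρ ^ (m + 3))) * D i k

end

noncomputable section

open MeasureTheory Polynomial

/-! ### Gradient and Laplacian of `Re g(z) q(‖z‖²)` -/

/-! Every basis function has the form `Y_{m,j} q(r²)` with a real polynomial `q`, so the whole
theorem is a statement about polynomials in `s = r²`.

On this form the Laplacian acts as `L q = 4 (s q'' + (m + 1) q')` (`laplacian_modeFun`). In polar
coordinates the angular integrals kill the Dirichlet form of two different modes, which gives the
block structure. For equal modes they leave the form `radialEnergy` on `(α, 1)`, with `α = ρ²` for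
the annulus and `α = 0` for the disk (`setIntegral_annulus_inner_gradient`). It does not involve
`j`, hence equal blocks for both signs.

Since `s^m L q = 4 (s^(m+1) q')'`, integration by parts turns the energy of `q` and `p` into
`-(π_m/2) ∫ s^m (L q) p` when `p` vanishes at the boundary (`radialEnergy_eq_neg_integral`). For
bubbles `β p_k`, with `β = 1 - s` or `β = (1 - s)(s - ρ²)`, the factor `s^m β` is exactly the weight
for which the `p_k` are orthogonal. Hence the energy of `β p_i` and `β p_k` is `-(π_m/2) κ D i k`,
where `D` is the matrix of `p ↦ L (β p)` in the basis `p_k` and `κ` is the common squared norm.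

The energy is symmetric, so `D` is symmetric. As `L` lowers degrees by one, `D` vanishes more than
`deg β - 1` places below the diagonal, and by symmetry also above it: diagonal for the disk,
tridiagonal for the annulus (`existsUnique_banded`).

A hat function has `q` constant (disk) or linear (annulus), so `L q` is a constant. It is therefore
orthogonal to every `p_k` with `k > 0`, and a hat couples with at most the first bubble. The hat-hat
entries are elementary integrals. -/

/-- The function `Re g(z) q(‖z‖²)` of the plane. -/
def reMulRadial (g : ℂ[X]) (q : ℝ[X]) (z : ℂ) : ℝ := (g.eval z).re * q.eval (‖z‖ ^ 2)

/-- By the Cauchy-Riemann equations the gradient of `Re g` is the conjugate of `g'`. -/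
theorem hasFDerivAt_re_eval (g : ℂ[X]) (z : ℂ) :
    HasFDerivAt (fun z : ℂ => (g.eval z).re)
      (innerSL ℝ ((starRingEnd ℂ) (g.derivative.eval z))) z := by
  have h := (Complex.reCLM.hasFDerivAt).comp z
    ((g.hasDerivAt z).hasFDerivAt.restrictScalars ℝ)
  refine h.congr_fderiv ?_
  ext; simp [Complex.inner]

theorem hasFDerivAt_eval_norm_sq (q : ℝ[X]) (z : ℂ) :
    HasFDerivAt (fun z : ℂ => q.eval (‖z‖ ^ 2))
      ((2 * q.derivative.eval (‖z‖ ^ 2)) • innerSL ℝ z) z := by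
  have h := (q.hasDerivAt (‖z‖ ^ 2)).comp_hasFDerivAt z (hasStrictFDerivAt_norm_sq z).hasFDerivAt
  refine h.congr_fderiv ?_
  ext; simp; ring

theorem hasFDerivAt_reMulRadial (g : ℂ[X]) (q : ℝ[X]) (z : ℂ) :
    HasFDerivAt (reMulRadial g q)
      (innerSL ℝ (((q.eval (‖z‖ ^ 2) : ℝ) : ℂ) * (starRingEnd ℂ) (g.derivative.eval z) +
        ((2 * q.derivative.eval (‖z‖ ^ 2) * (g.eval z).re : ℝ) : ℂ) * z)) z := by
  refine ((hasFDerivAt_re_eval g z).mul (hasFDerivAt_eval_norm_sq q z)).congr_fderiv ?_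
  ext; simp [Complex.inner]; ring

theorem gradient_reMulRadial (g : ℂ[X]) (q : ℝ[X]) (z : ℂ) :
    gradient (reMulRadial g q) z =
      ((q.eval (‖z‖ ^ 2) : ℝ) : ℂ) * (starRingEnd ℂ) (g.derivative.eval z) +
        ((2 * q.derivative.eval (‖z‖ ^ 2) * (g.eval z).re : ℝ) : ℂ) * z :=
  HasGradientAt.gradient (hasGradientAt_iff_hasFDerivAt.2 (hasFDerivAt_reMulRadial g q z))

theorem continuous_gradient_reMulRadial (g : ℂ[X]) (q : ℝ[X]) :
    Continuous (gradient (reMulRadial g q)) := by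
  simp_rw [funext (gradient_reMulRadial g q)]
  have h1 : Continuous fun z : ℂ => q.eval (‖z‖ ^ 2) := q.continuous.comp (by fun_prop)
  have h2 : Continuous fun z : ℂ => q.derivative.eval (‖z‖ ^ 2) :=
    q.derivative.continuous.comp (by fun_prop)
  have h3 : Continuous fun z : ℂ => (g.eval z).re := Complex.continuous_re.comp g.continuous
  have h4 : Continuous fun z : ℂ => (starRingEnd ℂ) (g.derivative.eval z) :=
    Complex.continuous_conj.comp g.derivative.continuous
  fun_prop

/-- Directional derivatives stay within sums of `reMulRadial` functions times linear forms, so the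
formula can be iterated to reach second derivatives. -/
theorem fderiv_reMulRadial_apply (g : ℂ[X]) (q : ℝ[X]) (v z : ℂ) :
    fderiv ℝ (reMulRadial g q) z v =
      reMulRadial (C v * g.derivative) q z +
        2 * (reMulRadial g q.derivative z * inner ℝ v z) := by
  rw [(hasFDerivAt_reMulRadial g q z).fderiv]
  simp [Complex.inner, reMulRadial]
  ring

theorem contDiff_reMulRadial (g : ℂ[X]) (q : ℝ[X]) {n : WithTop ℕ∞} :
    ContDiff ℝ n (reMulRadial g q) := by
  have h1 : ContDiff ℝ n fun z : ℂ => g.eval z :=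
    (by simpa using contDiff_aeval (𝕜 := ℂ) g n : ContDiff ℂ n fun z : ℂ => g.eval z).restrict_scalars ℝ
  have h2 : ContDiff ℝ n fun z : ℂ => q.eval (‖z‖ ^ 2) :=
    (by simpa using contDiff_aeval (𝕜 := ℝ) q n : ContDiff ℝ n fun x : ℝ => q.eval x).comp
      (contDiff_norm_sq ℝ)
  exact (Complex.reCLM.contDiff.comp h1).mul h2

theorem iteratedFDeriv_two_reMulRadial (g : ℂ[X]) (q : ℝ[X]) (v z : ℂ) :
    iteratedFDeriv ℝ 2 (reMulRadial g q) z ![v, v] =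
      reMulRadial (C v * (C v * g.derivative.derivative)) q z +
        4 * (reMulRadial (C v * g.derivative) q.derivative z * inner ℝ v z) +
        4 * (reMulRadial g q.derivative.derivative z * inner ℝ v z ^ 2) +
        2 * (reMulRadial g q.derivative z * ‖v‖ ^ 2) := by
  have hd : DifferentiableAt ℝ (fderiv ℝ (reMulRadial g q)) z :=
    ((contDiff_reMulRadial g q (n := 2)).fderiv_right (m := 1) (by norm_num)).differentiable
      (by norm_num) z
  have h1 : iteratedFDeriv ℝ 2 (reMulRadial g q) z ![v, v] =
      fderiv ℝ (fun y => fderiv ℝ (reMulRadial g q) y v) z v := by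
    rw [iteratedFDeriv_two_apply, fderiv_clm_apply hd (by fun_prop)]
    simp
  rw [h1, funext (fderiv_reMulRadial_apply g q v)]
  have d1 := hasFDerivAt_reMulRadial (C v * g.derivative) q z
  have d2 := hasFDerivAt_reMulRadial g q.derivative z
  have d3 : HasFDerivAt (fun y : ℂ => inner ℝ v y) (innerSL ℝ v) z := (innerSL ℝ v).hasFDerivAt
  have d4 := d1.add ((d2.mul d3).const_mul 2)
  have e1 := fderiv_reMulRadial_apply (C v * g.derivative) q v z
  have e2 := fderiv_reMulRadial_apply g q.derivative v z
  rw [d1.fderiv] at e1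
  rw [d2.fderiv] at e2
  refine (congrArg (fun L => L v) d4.fderiv).trans ?_
  simp only [add_apply, smul_apply, e1, e2, innerSL_apply_apply, smul_eq_mul,
    real_inner_self_eq_norm_sq]
  rw [derivative_C_mul]
  ring

/-- In the sum over the directions `1` and `I` the terms with `g''` cancel because `1² + I² = 0`,
that is, `Re g` is harmonic. Only the cross term and the Laplacian of the radial factor remain. -/
theorem laplacian_reMulRadial (g : ℂ[X]) (q : ℝ[X]) (z : ℂ) :
    Laplacian.laplacian (reMulRadial g q) z =
      4 * (reMulRadial (X * g.derivative) q.derivative z +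
        reMulRadial g (X * q.derivative.derivative + q.derivative) z) := by
  rw [InnerProductSpace.laplacian_eq_iteratedFDeriv_complexPlane]
  simp only [iteratedFDeriv_two_reMulRadial]
  simp [reMulRadial, Complex.inner, Complex.sq_norm, Complex.normSq_apply]
  ring

/-! ### Functions of a single Fourier mode -/

/-- The polynomial in `z` with real part `Y_{m,j}`. -/
def modePoly (m : ℕ) (j : Fin 2) : ℂ[X] := C (if j = 1 then 1 else -Complex.I) * X ^ m

theorem harmonicY_eq_re (m : ℕ) (j : Fin 2) (z : ℂ) :
    harmonicY m j z = ((modePoly m j).eval z).re := by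
  rw [harmonicY_eq, modePoly]
  split_ifs <;> simp

/-- The function `Y_{m,j} q(r²)`. -/
def modeFun (m : ℕ) (j : Fin 2) (q : ℝ[X]) (z : ℂ) : ℝ := harmonicY m j z * q.eval (‖z‖ ^ 2)

theorem modeFun_eq (m : ℕ) (j : Fin 2) (q : ℝ[X]) : modeFun m j q = reMulRadial (modePoly m j) q := by
  funext z
  rw [modeFun, reMulRadial, harmonicY_eq_re]

/-- The Laplacian on functions `Y_{m,j} q(r²)`, as an operator on the polynomial `q`. -/
def radialLaplacian (m : ℕ) (q : ℝ[X]) : ℝ[X] :=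
  C 4 * (X * q.derivative.derivative + C (m + 1 : ℝ) * q.derivative)

theorem laplacian_modeFun (m : ℕ) (j : Fin 2) (q : ℝ[X]) (z : ℂ) :
    Laplacian.laplacian (modeFun m j q) z = modeFun m j (radialLaplacian m q) z := by
  -- Euler's identity for `z^m`: it turns the cross term into `m q'`, which joins `q'` to give the
  -- factor `m + 1`.
  have h : X * (modePoly m j).derivative = C (m : ℂ) * modePoly m j := by
    rw [modePoly, derivative_C_mul, derivative_X_pow]
    rcases m with _ | m
    · simp
    · simp only [Nat.add_sub_cancel]; ring
  rw [modeFun_eq, modeFun_eq, laplacian_reMulRadial, h]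
  simp only [reMulRadial, radialLaplacian, eval_mul, eval_add, eval_C, eval_X]
  rw [show ((m : ℂ) * (modePoly m j).eval z).re = m * ((modePoly m j).eval z).re by simp]
  ring

/-! ### The Dirichlet form on functions of Fourier modes -/

/-- The angular factor of `Y_{m,j}`. -/
def modeAngle (m : ℕ) (j : Fin 2) (θ : ℝ) : ℝ :=
  if j = 1 then Real.cos (m * θ) else Real.sin (m * θ)

/-- The angular factor of the harmonic conjugate of `Y_{m,j}`. -/
def modeConjAngle (m : ℕ) (j : Fin 2) (θ : ℝ) : ℝ :=
  if j = 1 then Real.sin (m * θ) else -Real.cos (m * θ)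

theorem modePoly_eval_polar (m : ℕ) (j : Fin 2) (p : ℝ × ℝ) :
    (modePoly m j).eval (Complex.polarCoord.symm p) =
      ((p.1 ^ m * modeAngle m j p.2 : ℝ) : ℂ) +
        ((p.1 ^ m * modeConjAngle m j p.2 : ℝ) : ℂ) * Complex.I := by
  rw [Complex.polarCoord_symm_apply, modePoly, eval_C_mul, eval_pow, eval_X, mul_pow,
    Complex.ofReal_cos, Complex.ofReal_sin, Complex.cos_add_sin_mul_I_pow]
  unfold modeAngle modeConjAngle
  split_ifs
  · push_cast; ring
  · push_cast; linear_combination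
      (-(p.1 : ℂ) ^ m * Complex.sin (m * p.2)) * Complex.I_mul_I

theorem mul_derivative_modePoly_eval (m : ℕ) (j : Fin 2) (z : ℂ) :
    z * (modePoly m j).derivative.eval z = m * (modePoly m j).eval z := by
  rw [modePoly, derivative_C_mul, derivative_X_pow]
  rcases m with _ | m
  · simp
  · simp; ring_nf

/-- The factor `‖z‖²` makes the derivatives occur only as `z g'(z)`, which for a mode polynomial is
`m g(z)`; no power `z^(m-1)` has to be handled. -/
theorem inner_gradient_reMulRadial (g h : ℂ[X]) (q p : ℝ[X]) (z : ℂ) :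
    ‖z‖ ^ 2 * inner ℝ (gradient (reMulRadial g q) z) (gradient (reMulRadial h p) z) =
      q.eval (‖z‖ ^ 2) * p.eval (‖z‖ ^ 2) *
          ((z * g.derivative.eval z) * (starRingEnd ℂ) (z * h.derivative.eval z)).re +
        ‖z‖ ^ 2 * (2 * q.eval (‖z‖ ^ 2) * p.derivative.eval (‖z‖ ^ 2) * (h.eval z).re *
            (z * g.derivative.eval z).re +
          2 * q.derivative.eval (‖z‖ ^ 2) * p.eval (‖z‖ ^ 2) * (g.eval z).re *
            (z * h.derivative.eval z).re +
          4 * q.derivative.eval (‖z‖ ^ 2) * p.derivative.eval (‖z‖ ^ 2) * (g.eval z).re *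
            (h.eval z).re * ‖z‖ ^ 2) := by
  rw [gradient_reMulRadial, gradient_reMulRadial]
  have h : ‖z‖ ^ 2 = z.re * z.re + z.im * z.im := by rw [Complex.sq_norm, Complex.normSq_apply]
  simp [Complex.inner]
  generalize eval (‖z‖ ^ 2) q = a
  generalize eval (‖z‖ ^ 2) p = b
  generalize eval (‖z‖ ^ 2) (derivative q) = c
  generalize eval (‖z‖ ^ 2) (derivative p) = d
  rw [h]
  ring

/-- The radial factor of the product of the radial derivatives, with the mixed terms. -/
def radialPart (m m' : ℕ) (q p : ℝ[X]) (r : ℝ) : ℝ :=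
  r ^ (m + m' + 1) * (2 * m * (q.eval (r ^ 2) * p.derivative.eval (r ^ 2)) +
    2 * m' * (q.derivative.eval (r ^ 2) * p.eval (r ^ 2)) +
    4 * (r ^ 2 * (q.derivative.eval (r ^ 2) * p.derivative.eval (r ^ 2))))

/-- The radial factor of the product of the gradients of the harmonic parts. -/
def harmonicPart (m m' : ℕ) (q p : ℝ[X]) (r : ℝ) : ℝ :=
  m * m' * (r ^ (m + m' - 1) * (q.eval (r ^ 2) * p.eval (r ^ 2)))

theorem continuous_radialPart (m m' : ℕ) (q p : ℝ[X]) : Continuous (radialPart m m' q p) := by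
  unfold radialPart; fun_prop

theorem continuous_harmonicPart (m m' : ℕ) (q p : ℝ[X]) : Continuous (harmonicPart m m' q p) := by
  unfold harmonicPart; fun_prop

theorem inner_gradient_modeFun_polar (m m' : ℕ) (j j' : Fin 2) (q q' : ℝ[X]) (p : ℝ × ℝ)
    (hp : 0 < p.1) :
    p.1 * inner ℝ (gradient (modeFun m j q) (Complex.polarCoord.symm p))
        (gradient (modeFun m' j' q') (Complex.polarCoord.symm p)) =
      radialPart m m' q q' p.1 * (modeAngle m j p.2 * modeAngle m' j' p.2) +
        harmonicPart m m' q q' p.1 * (modeAngle m j p.2 * modeAngle m' j' p.2 +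
          modeConjAngle m j p.2 * modeConjAngle m' j' p.2) := by
  have h := inner_gradient_reMulRadial (modePoly m j) (modePoly m' j') q q'
    (Complex.polarCoord.symm p)
  rw [← modeFun_eq, ← modeFun_eq, mul_derivative_modePoly_eval, mul_derivative_modePoly_eval,
    modePoly_eval_polar, modePoly_eval_polar, Complex.norm_polarCoord_symm, sq_abs] at h
  refine mul_left_cancel₀ hp.ne' ?_
  rw [← mul_assoc, ← sq, h]
  -- The truncated exponent `m + m' - 1` in `harmonicPart` is harmless: if `m = 0`, the factor `m *
  -- m'` vanishes.
  have e : p.1 * harmonicPart m m' q q' p.1 =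
      m * m' * (p.1 ^ (m + m') * (q.eval (p.1 ^ 2) * q'.eval (p.1 ^ 2))) := by
    unfold harmonicPart
    rcases m with _ | m
    · simp
    · rw [show m + 1 + m' = m + m' + 1 by ring, Nat.add_sub_cancel]; ring
  rw [mul_add p.1, ← mul_assoc p.1 (harmonicPart _ _ _ _ _), e, radialPart]
  simp only [Complex.mul_re, Complex.mul_im, Complex.add_re, Complex.add_im, Complex.ofReal_re,
    Complex.ofReal_im, Complex.I_re, Complex.I_im, Complex.natCast_re, Complex.natCast_im,
    Complex.conj_re, Complex.conj_im, map_mul]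
  ring

theorem setIntegral_annulus_eq_polar {ρ : ℝ} (hρ : 0 ≤ ρ) (f : ℂ → ℝ) :
    ∫ z in annulus ρ, f z =
      ∫ p in Set.Ioo ρ 1 ×ˢ Set.Ioo (-Real.pi) Real.pi, p.1 * f (Complex.polarCoord.symm p) := by
  have hm : MeasurableSet (annulus ρ) :=
    (measurableSet_lt measurable_const measurable_norm).inter
      (measurableSet_lt measurable_norm measurable_const)
  have hs : Set.Ioo ρ 1 ×ˢ Set.Ioo (-Real.pi) Real.pi ⊆ polarCoord.target :=
    Set.prod_mono (fun r hr => hρ.trans_lt hr.1) subset_rfl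
  rw [← integral_indicator hm, ← Complex.integral_comp_polarCoord_symm]
  rw [← Set.inter_eq_self_of_subset_right hs,
    ← setIntegral_indicator (measurableSet_Ioo.prod measurableSet_Ioo)]
  refine setIntegral_congr_fun polarCoord.open_target.measurableSet fun p hp => ?_
  have hp1 : 0 < p.1 := hp.1
  by_cases h : p.1 ∈ Set.Ioo ρ 1
  · have h1 : Complex.polarCoord.symm p ∈ annulus ρ := by
      rw [annulus, Set.mem_ofPred_eq, Complex.norm_polarCoord_symm, abs_of_pos hp1]; exact h
    have h2 : p ∈ Set.Ioo ρ 1 ×ˢ Set.Ioo (-Real.pi) Real.pi := ⟨h, hp.2⟩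
    simp only [Set.indicator_of_mem h1, Set.indicator_of_mem h2, smul_eq_mul]
  · have h1 : Complex.polarCoord.symm p ∉ annulus ρ := by
      rw [annulus, Set.mem_ofPred_eq, Complex.norm_polarCoord_symm, abs_of_pos hp1]; exact h
    have h2 : p ∉ Set.Ioo ρ 1 ×ˢ Set.Ioo (-Real.pi) Real.pi := fun h' => h h'.1
    simp only [Set.indicator_of_notMem h1, Set.indicator_of_notMem h2, smul_zero]

theorem integral_cos_int_mul (k : ℤ) :
    ∫ θ in (-Real.pi)..Real.pi, Real.cos (k * θ) = if k = 0 then 2 * Real.pi else 0 := by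
  split_ifs with h
  · subst h; simp; ring
  · have hk : (k : ℝ) ≠ 0 := by exact_mod_cast h
    rw [intervalIntegral.integral_comp_mul_left _ hk, integral_cos]
    simp [Real.sin_int_mul_pi]

theorem integral_sin_int_mul (k : ℤ) :
    ∫ θ in (-Real.pi)..Real.pi, Real.sin (k * θ) = 0 := by
  by_cases h : k = 0
  · subst h; simp
  · have hk : (k : ℝ) ≠ 0 := by exact_mod_cast h
    rw [intervalIntegral.integral_comp_mul_left _ hk, integral_sin]
    simp

theorem continuous_modeAngle (m : ℕ) (j : Fin 2) : Continuous (modeAngle m j) := by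
  unfold modeAngle; split_ifs <;> fun_prop

theorem continuous_modeConjAngle (m : ℕ) (j : Fin 2) : Continuous (modeConjAngle m j) := by
  unfold modeConjAngle; split_ifs <;> fun_prop

theorem integral_cos_nat_mul_sin_nat_mul (m n : ℕ) :
    ∫ θ in (-Real.pi)..Real.pi, Real.cos (m * θ) * Real.sin (n * θ) = 0 := by
  have hs (k : ℤ) : IntervalIntegrable (fun θ : ℝ => Real.sin (k * θ)) volume
    (-Real.pi) Real.pi := (by fun_prop : Continuous _).intervalIntegrable _ _
  have h : ∀ θ : ℝ, Real.cos (m * θ) * Real.sin (n * θ) =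
      2⁻¹ * (Real.sin (((m + n : ℤ) : ℝ) * θ) - Real.sin (((m - n : ℤ) : ℝ) * θ)) := by
    intro θ
    push_cast
    rw [add_mul, sub_mul, Real.sin_add, Real.sin_sub]
    ring
  simp_rw [h]
  rw [intervalIntegral.integral_const_mul, intervalIntegral.integral_sub (hs _) (hs _),
    integral_sin_int_mul, integral_sin_int_mul]
  simp

theorem integral_cos_nat_mul_cos_nat_mul (m n : ℕ) :
    ∫ θ in (-Real.pi)..Real.pi, Real.cos (m * θ) * Real.cos (n * θ) =
      if m = n then fourierPi m else 0 := by
  have hs (k : ℤ) : IntervalIntegrable (fun θ : ℝ => Real.cos (k * θ)) volume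
    (-Real.pi) Real.pi := (by fun_prop : Continuous _).intervalIntegrable _ _
  have h : ∀ θ : ℝ, Real.cos (m * θ) * Real.cos (n * θ) =
      2⁻¹ * (Real.cos (((m - n : ℤ) : ℝ) * θ) + Real.cos (((m + n : ℤ) : ℝ) * θ)) := by
    intro θ
    push_cast
    rw [add_mul, sub_mul, Real.cos_add, Real.cos_sub]
    ring
  simp_rw [h]
  rw [intervalIntegral.integral_const_mul, intervalIntegral.integral_add (hs _) (hs _),
    integral_cos_int_mul, integral_cos_int_mul]
  unfold fourierPi
  split_ifs <;> first | omega | ring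

theorem integral_sin_nat_mul_sin_nat_mul (m n : ℕ) (hm : m ≠ 0) :
    ∫ θ in (-Real.pi)..Real.pi, Real.sin (m * θ) * Real.sin (n * θ) =
      if m = n then fourierPi m else 0 := by
  have hs (k : ℤ) : IntervalIntegrable (fun θ : ℝ => Real.cos (k * θ)) volume
    (-Real.pi) Real.pi := (by fun_prop : Continuous _).intervalIntegrable _ _
  have h : ∀ θ : ℝ, Real.sin (m * θ) * Real.sin (n * θ) =
      2⁻¹ * (Real.cos (((m - n : ℤ) : ℝ) * θ) - Real.cos (((m + n : ℤ) : ℝ) * θ)) := by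
    intro θ
    push_cast
    rw [add_mul, sub_mul, Real.cos_add, Real.cos_sub]
    ring
  simp_rw [h]
  rw [intervalIntegral.integral_const_mul, intervalIntegral.integral_sub (hs _) (hs _),
    integral_cos_int_mul, integral_cos_int_mul]
  unfold fourierPi
  split_ifs <;> first | omega | ring

/-- The mode condition excludes `(0, 0)`, whose angular factor `sin 0` has norm zero instead of
`fourierPi 0`. -/
theorem integral_modeAngle_mul (m m' : ℕ) (j j' : Fin 2) (hm : IsFourierMode m j) :
    ∫ θ in (-Real.pi)..Real.pi, modeAngle m j θ * modeAngle m' j' θ =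
      if (m, j) = (m', j') then fourierPi m else 0 := by
  unfold modeAngle
  by_cases h : j = 1 <;> by_cases h' : j' = 1
  · subst h; subst h'
    simpa using integral_cos_nat_mul_cos_nat_mul m m'
  · subst h
    have h0 : j' = 0 := by omega
    subst h0
    simpa using integral_cos_nat_mul_sin_nat_mul m m'
  · subst h'
    have h0 : j = 0 := by omega
    subst h0
    simpa [mul_comm] using integral_cos_nat_mul_sin_nat_mul m' m
  · have h0 : j = 0 := by omega
    have h0' : j' = 0 := by omega
    subst h0; subst h0'
    simpa using integral_sin_nat_mul_sin_nat_mul m m' fun hm0 => h (hm hm0)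

/-- By the addition formulas the integrand is, up to sign, the cosine (`j = j'`) or the sine (`j ≠
j'`) of `(m - m') θ`. At equal indices it is the constant `1`, even for `(0, 0)`. -/
theorem integral_modeAngle_mul_add (m m' : ℕ) (j j' : Fin 2) :
    ∫ θ in (-Real.pi)..Real.pi, (modeAngle m j θ * modeAngle m' j' θ +
        modeConjAngle m j θ * modeConjAngle m' j' θ) =
      if (m, j) = (m', j') then 2 * Real.pi else 0 := by
  unfold modeAngle modeConjAngle
  have hc : ∫ θ in (-Real.pi)..Real.pi, Real.cos (m * θ - m' * θ) =
      if m = m' then 2 * Real.pi else 0 := by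
    have := integral_cos_int_mul (m - m')
    simpa [sub_mul, sub_eq_zero] using this
  have hs : ∫ θ in (-Real.pi)..Real.pi, Real.sin (m * θ - m' * θ) = 0 := by
    have := integral_sin_int_mul (m - m')
    simpa [sub_mul] using this
  by_cases h : j = 1 <;> by_cases h' : j' = 1
  · subst h; subst h'
    simpa [Real.cos_sub] using hc
  · subst h
    have h0 : j' = 0 := by omega
    subst h0
    simp only [zero_ne_one, if_false, if_true, Prod.mk.injEq, one_ne_zero, and_false]
    rw [← neg_eq_zero, ← intervalIntegral.integral_neg, ← hs]
    congr 1; ext θ; rw [Real.sin_sub]; ring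
  · subst h'
    have h0 : j = 0 := by omega
    subst h0
    simp only [zero_ne_one, if_false, if_true, Prod.mk.injEq, and_false]
    rw [← hs]
    congr 1; ext θ; rw [Real.sin_sub]; ring
  · have h0 : j = 0 := by omega
    have h0' : j' = 0 := by omega
    subst h0; subst h0'
    simp only [zero_ne_one, if_false, Prod.mk.injEq, and_true]
    rw [← hc]
    congr 1; ext θ; rw [Real.cos_sub]; ring

/-- The Dirichlet form of `Y_{m,j} q(r²)` and `Y_{m,j} p(r²)` on the annulus `α < r² < 1`. -/
def radialEnergy (α : ℝ) (m : ℕ) (q p : ℝ[X]) : ℝ :=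
  fourierPi m * (m * (q.eval 1 * p.eval 1 - α ^ m * (q.eval α * p.eval α)) +
    2 * ∫ s in α..1, s ^ (m + 1) * (q.derivative.eval s * p.derivative.eval s))

/-- With `s = r²` the integrand is `2r` times `m (s^m q p)' + 2 s^(m+1) q' p'`. The first summand is
a total derivative and yields the boundary terms. -/
theorem integral_radialPart_add (ρ : ℝ) (m : ℕ) (q p : ℝ[X]) :
    ∫ r in ρ..1, (radialPart m m q p r + 2 * harmonicPart m m q p r) =
      m * (q.eval 1 * p.eval 1 - (ρ ^ 2) ^ m * (q.eval (ρ ^ 2) * p.eval (ρ ^ 2))) +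
        2 * ∫ s in (ρ ^ 2)..1, s ^ (m + 1) * (q.derivative.eval s * p.derivative.eval s) := by
  let G : ℝ → ℝ := fun s => m * (X ^ m * (q * p)).derivative.eval s +
    2 * (s ^ (m + 1) * (q.derivative.eval s * p.derivative.eval s))
  have hG : Continuous G := by fun_prop
  have h1 : ∫ r in ρ..1, (radialPart m m q p r + 2 * harmonicPart m m q p r) =
      ∫ r in ρ..1, (G ∘ fun r => r ^ 2) r * (2 * r) := by
    refine intervalIntegral.integral_congr fun r _ => ?_
    simp only [radialPart, harmonicPart, G, Function.comp, derivative_mul, derivative_X_pow,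
      eval_add, eval_mul, eval_pow, eval_X, eval_C]
    rcases m with _ | m
    · simp; ring
    · rw [show m + 1 + (m + 1) - 1 = 2 * m + 1 by omega, Nat.add_sub_cancel]
      push_cast
      ring
  have h2 : ∫ r in ρ..1, (G ∘ fun r => r ^ 2) r * (2 * r) = ∫ s in (ρ ^ 2)..(1 ^ 2), G s :=
    intervalIntegral.integral_comp_mul_deriv (f := fun r => r ^ 2) (f' := fun r => 2 * r)
      (fun r _ => by simpa using hasDerivAt_pow 2 r) (by fun_prop) hG
  rw [h1, h2, one_pow, intervalIntegral.integral_add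
    ((by fun_prop : Continuous _).intervalIntegrable _ _)
    ((by fun_prop : Continuous _).intervalIntegrable _ _),
    intervalIntegral.integral_const_mul, intervalIntegral.integral_const_mul,
    intervalIntegral.integral_eq_sub_of_hasDerivAt (fun s _ => Polynomial.hasDerivAt _ s)
    ((by fun_prop : Continuous _).intervalIntegrable _ _)]
  simp

theorem setIntegral_annulus_inner_gradient {ρ : ℝ} (hρ : 0 ≤ ρ) (hρ1 : ρ < 1) {m m' : ℕ}
    {j j' : Fin 2} (hm : IsFourierMode m j) (q p : ℝ[X]) :
    ∫ z in annulus ρ, inner ℝ (gradient (modeFun m j q) z) (gradient (modeFun m' j' p) z) =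
      if (m, j) = (m', j') then radialEnergy (ρ ^ 2) m q p else 0 := by
  rw [setIntegral_annulus_eq_polar hρ]
  have hK : Set.Ioo ρ 1 ×ˢ Set.Ioo (-Real.pi) Real.pi ⊆
    Set.Icc ρ 1 ×ˢ Set.Icc (-Real.pi) Real.pi :=
    Set.prod_mono Set.Ioo_subset_Icc_self Set.Ioo_subset_Icc_self
  have hint {f : ℝ × ℝ → ℝ} (hf : Continuous f) :
      IntegrableOn f (Set.Ioo ρ 1 ×ˢ Set.Ioo (-Real.pi) Real.pi) volume :=
    (hf.continuousOn.integrableOn_compact (isCompact_Icc.prod isCompact_Icc)).mono_set hK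
  have cA := continuous_radialPart m m' q p
  have cB := continuous_harmonicPart m m' q p
  have c1 := continuous_modeAngle m j
  have c2 := continuous_modeAngle m' j'
  have c3 := continuous_modeConjAngle m j
  have c4 := continuous_modeConjAngle m' j'
  have hset : ∫ p' in Set.Ioo ρ 1 ×ˢ Set.Ioo (-Real.pi) Real.pi,
      p'.1 * inner ℝ (gradient (modeFun m j q) (Complex.polarCoord.symm p'))
        (gradient (modeFun m' j' p) (Complex.polarCoord.symm p')) =
      ∫ p' in Set.Ioo ρ 1 ×ˢ Set.Ioo (-Real.pi) Real.pi,
        (radialPart m m' q p p'.1 * (modeAngle m j p'.2 * modeAngle m' j' p'.2) +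
        harmonicPart m m' q p p'.1 * (modeAngle m j p'.2 * modeAngle m' j' p'.2 +
          modeConjAngle m j p'.2 * modeConjAngle m' j' p'.2)) :=
    setIntegral_congr_fun (measurableSet_Ioo.prod measurableSet_Ioo) fun p' hp' =>
      inner_gradient_modeFun_polar m m' j j' q p p' (hρ.trans_lt hp'.1.1)
  rw [hset, integral_add (hint (by fun_prop)) (hint (by fun_prop)), Measure.volume_eq_prod,
    setIntegral_prod_mul (radialPart m m' q p) (fun θ => modeAngle m j θ * modeAngle m' j' θ),
    setIntegral_prod_mul (harmonicPart m m' q p) (fun θ => modeAngle m j θ * modeAngle m' j' θ +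
          modeConjAngle m j θ * modeConjAngle m' j' θ)]
  have hπ : -Real.pi ≤ Real.pi := by linarith [Real.pi_pos]
  simp only [← integral_Ioc_eq_integral_Ioo, ← intervalIntegral.integral_of_le hρ1.le,
    ← intervalIntegral.integral_of_le hπ, integral_modeAngle_mul m m' j j' hm,
    integral_modeAngle_mul_add]
  split_ifs with h
  · obtain ⟨rfl, rfl⟩ := Prod.mk.inj h
    rw [radialEnergy, ← integral_radialPart_add, intervalIntegral.integral_add
      (cA.intervalIntegrable _ _) ((cB.const_mul 2).intervalIntegrable _ _),
      intervalIntegral.integral_const_mul]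
    -- The harmonic part carries the angular constant `2π`, the radial part `fourierPi m`. For `m ≥
    -- 1` this is a ratio of `2`; for `m = 0` the harmonic part is zero.
    rcases Nat.eq_zero_or_pos m with rfl | h0
    · simp [harmonicPart]; ring
    · rw [fourierPi, if_neg h0.ne']; ring
  · simp

theorem integrableOn_inner_gradient {Ω : Set ℂ} (hΩ : Ω ⊆ unitDisk) (m m' : ℕ) (j j' : Fin 2)
    (q p : ℝ[X]) : IntegrableOn (fun z => inner ℝ (gradient (modeFun m j q) z)
      (gradient (modeFun m' j' p) z)) Ω volume := by
  have h : Continuous fun z => inner ℝ (gradient (modeFun m j q) z)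
      (gradient (modeFun m' j' p) z) := by
    rw [modeFun_eq, modeFun_eq]
    exact (continuous_gradient_reMulRadial _ _).inner (continuous_gradient_reMulRadial _ _)
  refine (h.continuousOn.integrableOn_compact (isCompact_closedBall (0 : ℂ) 1)).mono_set ?_
  intro z hz
  simpa using (hΩ hz : ‖z‖ < 1).le

theorem annulus_subset_unitDisk (ρ : ℝ) : annulus ρ ⊆ unitDisk := fun _ hz => hz.2

/-- The disk differs from the annulus of inner radius `0` only by the origin, a null set. -/
theorem setIntegral_unitDisk_inner_gradient {m m' : ℕ} {j j' : Fin 2} (hm : IsFourierMode m j)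
    (q p : ℝ[X]) :
    ∫ z in unitDisk, inner ℝ (gradient (modeFun m j q) z) (gradient (modeFun m' j' p) z) =
      if (m, j) = (m', j') then radialEnergy 0 m q p else 0 := by
  have h : (unitDisk : Set ℂ) =ᵐ[volume] annulus 0 := by
    have h0 : annulus 0 = unitDisk \ {0} := by
      ext z; simp [annulus, unitDisk, and_comm]
    rw [h0]
    exact (sdiff_ae_eq_self.2 (measure_mono_null Set.inter_subset_right (by simp))).symm
  rw [setIntegral_congr_set h, setIntegral_annulus_inner_gradient le_rfl one_pos hm]
  norm_num

theorem radialEnergy_comm (α : ℝ) (m : ℕ) (q p : ℝ[X]) :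
    radialEnergy α m q p = radialEnergy α m p q := by
  simp only [radialEnergy, mul_comm (q.eval _), mul_comm (q.derivative.eval _)]

/-- Green's formula in the variable `s`: integrate `(s^(m+1) q' p)'`. At `α = 0` the factor
`s^(m+1)` removes the boundary term, so `p` need not vanish there. -/
theorem radialEnergy_eq_neg_integral (α : ℝ) (m : ℕ) (q p : ℝ[X]) (h1 : p.eval 1 = 0)
    (hα : α = 0 ∨ p.eval α = 0) :
    radialEnergy α m q p =
      -(fourierPi m / 2) * ∫ s in α..1, s ^ m * ((radialLaplacian m q).eval s * p.eval s) := by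
  have e1 : (m : ℝ) * (α ^ m * (q.eval α * p.eval α)) = 0 := by
    rcases hα with rfl | h
    · rcases m with _ | m <;> simp
    · simp [h]
  have e2 : α ^ (m + 1) * (q.derivative.eval α * p.eval α) = 0 := by
    rcases hα with rfl | h
    · simp
    · simp [h]
  have key : ∫ s in α..1, (X ^ (m + 1) * (q.derivative * p)).derivative.eval s = 0 := by
    rw [intervalIntegral.integral_eq_sub_of_hasDerivAt (fun s _ => Polynomial.hasDerivAt _ s)
      ((by fun_prop : Continuous _).intervalIntegrable _ _)]
    simp [h1]
    simpa using e2
  have hsum : ∫ s in α..1, (X ^ (m + 1) * (q.derivative * p)).derivative.eval s =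
      (∫ s in α..1, s ^ (m + 1) * (q.derivative.eval s * p.derivative.eval s)) +
        4⁻¹ * ∫ s in α..1, s ^ m * ((radialLaplacian m q).eval s * p.eval s) := by
    rw [← intervalIntegral.integral_const_mul, ← intervalIntegral.integral_add
      ((by fun_prop : Continuous _).intervalIntegrable _ _)
      ((by fun_prop : Continuous _).intervalIntegrable _ _)]
    refine intervalIntegral.integral_congr fun s _ => ?_
    simp [radialLaplacian]
    ring
  rw [radialEnergy, h1, mul_sub, e1]
  rw [key] at hsum
  linear_combination (2 * fourierPi m) * (-hsum)

/-! ### Orthonormality of the Gram--Schmidt polynomials -/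

theorem monicOrthoPoly_monic_and_degree (lo hi : ℝ) (w : ℝ → ℝ) (n : ℕ) :
    (monicOrthoPoly lo hi w n).Monic ∧ (monicOrthoPoly lo hi w n).degree = n := by
  induction n using Nat.strong_induction_on with
  | _ n ih =>
    rw [monicOrthoPoly]
    have hlt : (∑ k : Fin n, C ((∫ x in lo..hi, x ^ n * (monicOrthoPoly lo hi w k).eval x * w x) /
        ∫ x in lo..hi, (monicOrthoPoly lo hi w k).eval x ^ 2 * w x) *
        monicOrthoPoly lo hi w k).degree < (X ^ n : ℝ[X]).degree := by
      rw [degree_X_pow]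
      refine (degree_sum_le _ _).trans_lt ((Finset.sup_lt_iff (WithBot.bot_lt_coe n)).2 ?_)
      intro k _
      rw [← smul_eq_C_mul]
      refine (degree_smul_le _ _).trans_lt ?_
      rw [(ih k k.2).2]
      exact WithBot.coe_lt_coe.2 k.2
    exact ⟨(monic_X_pow n).sub_of_left hlt, by rw [degree_sub_eq_left_of_degree_lt hlt, degree_X_pow]⟩

theorem monicOrthoPoly_zero (lo hi : ℝ) (w : ℝ → ℝ) : monicOrthoPoly lo hi w 0 = 1 := by
  rw [monicOrthoPoly]; simp

section Weight

variable {lo hi : ℝ} {w : ℝ → ℝ}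

/-- A nonzero polynomial has finitely many roots, so the nonnegative continuous integrand is
positive at some interior point. -/
theorem integral_sq_mul_weight_pos (h : lo < hi) (hw : Continuous w)
    (hpos : ∀ x ∈ Set.Ioo lo hi, 0 < w x) {p : ℝ[X]} (hp : p ≠ 0) :
    0 < ∫ x in lo..hi, p.eval x ^ 2 * w x := by
  have hpos' : ∀ x ∈ Set.Icc lo hi, 0 ≤ w x := by
    intro x hx
    rw [← closure_Ioo h.ne] at hx
    exact closure_minimal (fun y hy => (hpos y hy).le) (isClosed_Ici.preimage hw) hx
  obtain ⟨c, hc, hc0⟩ : ∃ c ∈ Set.Ioo lo hi, p.eval c ≠ 0 := by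
    by_contra! hcon
    refine (Set.Ioo_infinite h) ((p.roots.toFinset.finite_toSet).subset fun x hx => ?_)
    simpa [hp] using hcon x hx
  refine intervalIntegral.integral_pos h (by fun_prop)
    (fun x hx => mul_nonneg (sq_nonneg _) (hpos' x ⟨hx.1.le, hx.2⟩))
    ⟨c, Set.Ioo_subset_Icc_self hc, mul_pos (by positivity) (hpos c hc)⟩

/-- Strong induction: the earlier polynomials are already pairwise orthogonal, so only the `k`-th
summand survives, and its coefficient is chosen to cancel the component of `x^n` along it. -/
theorem integral_monicOrthoPoly_mul_eq_zero (h : lo < hi) (hw : Continuous w)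
    (hpos : ∀ x ∈ Set.Ioo lo hi, 0 < w x) (n : ℕ) :
    ∀ k < n, ∫ x in lo..hi, (monicOrthoPoly lo hi w n).eval x *
      (monicOrthoPoly lo hi w k).eval x * w x = 0 := by
  induction n using Nat.strong_induction_on with
  | _ n ih =>
    intro k hk
    have hoff : ∀ i < n, i ≠ k → ∫ x in lo..hi, (monicOrthoPoly lo hi w i).eval x *
        (monicOrthoPoly lo hi w k).eval x * w x = 0 := by
      intro i hi hik
      rcases lt_or_gt_of_ne hik with hlt | hlt
      · rw [← ih k hk i hlt]
        simp only [mul_comm ((monicOrthoPoly _ _ _ i).eval _)]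
      · exact ih i hi k hlt
    have hk0 : ∫ x in lo..hi, (monicOrthoPoly lo hi w k).eval x ^ 2 * w x ≠ 0 :=
      (integral_sq_mul_weight_pos h hw hpos (monicOrthoPoly_monic_and_degree lo hi w k).1.ne_zero).ne'
    set c : Fin n → ℝ := fun i =>
      (∫ x in lo..hi, x ^ n * (monicOrthoPoly lo hi w i).eval x * w x) /
        ∫ x in lo..hi, (monicOrthoPoly lo hi w i).eval x ^ 2 * w x with hc
    have e : ∀ x, (monicOrthoPoly lo hi w n).eval x *
        (monicOrthoPoly lo hi w k).eval x * w x =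
        x ^ n * (monicOrthoPoly lo hi w k).eval x * w x -
        ∑ i : Fin n, c i * ((monicOrthoPoly lo hi w i).eval x *
          (monicOrthoPoly lo hi w k).eval x * w x) := by
      intro x
      rw [monicOrthoPoly]
      simp only [hc, eval_sub, eval_pow, eval_X, eval_finsetSum, eval_mul, eval_C, sub_mul,
        Finset.sum_mul, mul_assoc]
    simp_rw [e]
    rw [intervalIntegral.integral_sub ((by fun_prop : Continuous _).intervalIntegrable _ _)
      ((by fun_prop : Continuous _).intervalIntegrable _ _),
      intervalIntegral.integral_finsetSum
        fun i _ => ((by fun_prop : Continuous _).intervalIntegrable _ _)]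
    simp_rw [intervalIntegral.integral_const_mul]
    rw [Finset.sum_eq_single (⟨k, hk⟩ : Fin n)
      (fun i _ hi => by rw [hoff i i.2 fun h' => hi (Fin.ext h'), mul_zero]) (by simp), hc]
    simp only [← sq]
    rw [div_mul_cancel₀ _ hk0, sub_self]

theorem integral_orthonormalPoly_mul (h : lo < hi) (hw : Continuous w)
    (hpos : ∀ x ∈ Set.Ioo lo hi, 0 < w x) (n k : ℕ) :
    ∫ x in lo..hi, (orthonormalPoly lo hi w n).eval x * (orthonormalPoly lo hi w k).eval x * w x =
      if n = k then 1 else 0 := by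
  have e : ∀ x, (orthonormalPoly lo hi w n).eval x * (orthonormalPoly lo hi w k).eval x * w x =
      (Real.sqrt (∫ x in lo..hi, (monicOrthoPoly lo hi w n).eval x ^ 2 * w x))⁻¹ *
      (Real.sqrt (∫ x in lo..hi, (monicOrthoPoly lo hi w k).eval x ^ 2 * w x))⁻¹ *
      ((monicOrthoPoly lo hi w n).eval x * (monicOrthoPoly lo hi w k).eval x * w x) := by
    intro x
    simp only [orthonormalPoly, eval_mul, eval_C]
    ring
  simp_rw [e]
  rw [intervalIntegral.integral_const_mul]
  split_ifs with hnk
  · subst hnk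
    have h0 := integral_sq_mul_weight_pos h hw hpos
      (monicOrthoPoly_monic_and_degree lo hi w n).1.ne_zero
    simp only [← sq]
    rw [inv_pow, Real.sq_sqrt h0.le, inv_mul_cancel₀ h0.ne']
  · rcases lt_or_gt_of_ne hnk with hlt | hlt
    · rw [← integral_monicOrthoPoly_mul_eq_zero h hw hpos k n hlt]
      simp only [mul_comm ((monicOrthoPoly lo hi w n).eval _)]
      rw [integral_monicOrthoPoly_mul_eq_zero h hw hpos k n hlt, mul_zero]
    · rw [integral_monicOrthoPoly_mul_eq_zero h hw hpos n k hlt, mul_zero]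

theorem degree_orthonormalPoly (h : lo < hi) (hw : Continuous w)
    (hpos : ∀ x ∈ Set.Ioo lo hi, 0 < w x) (n : ℕ) : (orthonormalPoly lo hi w n).degree = n := by
  have h0 := integral_sq_mul_weight_pos h hw hpos
    (monicOrthoPoly_monic_and_degree lo hi w n).1.ne_zero
  rw [orthonormalPoly, degree_C_mul (inv_ne_zero (Real.sqrt_pos.2 h0).ne'),
    (monicOrthoPoly_monic_and_degree lo hi w n).2]

theorem orthonormalPoly_zero :
    orthonormalPoly lo hi w 0 = C (Real.sqrt (∫ x in lo..hi, w x))⁻¹ := by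
  simp [orthonormalPoly, monicOrthoPoly_zero]

end Weight

/-! ### Matrices of operators in an orthogonal sequence of polynomials -/

/-- `p` is a sequence of polynomials with `deg p i = i`, orthogonal on `(α, 1)` for the weight `W`,
with the squared norms `κ`. -/
structure IsOrthoSeq (α : ℝ) (W : ℝ[X]) (κ : ℝ) (p : ℕ → ℝ[X]) : Prop where
  degree_eq : ∀ i, (p i).degree = i
  ne_zero : κ ≠ 0
  integral_mul : ∀ i k, ∫ s in α..1, W.eval s * ((p i).eval s * (p k).eval s) =
    if i = k then κ else 0

namespace IsOrthoSeq

variable {α κ : ℝ} {W : ℝ[X]} {p : ℕ → ℝ[X]}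

/-- Only the degrees matter: subtracting the multiple of `p n` with the same top coefficient lowers
the degree. -/
theorem exists_sum (h : IsOrthoSeq α W κ p) (n : ℕ) (q : ℝ[X]) (hq : q.degree < n) :
    ∃ c : ℕ → ℝ, q = ∑ i ∈ Finset.range n, c i • p i := by
  induction n generalizing q with
  | zero => exact ⟨0, by simpa [degree_lt_iff_coeff_zero, Polynomial.ext_iff] using hq⟩
  | succ n ih =>
    have hlead : (p n).leadingCoeff ≠ 0 := by
      rw [leadingCoeff_ne_zero, ← degree_ne_bot, h.degree_eq]; exact WithBot.coe_ne_bot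
    set a := q.coeff n / (p n).leadingCoeff with ha
    have hnat : (p n).natDegree = n := natDegree_eq_of_degree_eq_some (h.degree_eq n)
    have hlt : (q - a • p n).degree < n := by
      rw [degree_lt_iff_coeff_zero]
      intro i hi
      rcases hi.eq_or_lt with rfl | hi
      · rw [coeff_sub, coeff_smul, smul_eq_mul, ha, leadingCoeff, hnat, div_mul_cancel₀, sub_self]
        rwa [leadingCoeff, hnat] at hlead
      · rw [coeff_sub, coeff_smul, coeff_eq_zero_of_degree_lt (hq.trans_le (by exact_mod_cast hi)),
          coeff_eq_zero_of_degree_lt (by rw [h.degree_eq]; exact_mod_cast hi), smul_zero, sub_zero]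
    obtain ⟨c, hc⟩ := ih _ hlt
    refine ⟨fun i => if i = n then a else c i, ?_⟩
    simp only [Finset.sum_range_succ, if_pos]
    rw [← sub_eq_iff_eq_add, hc]
    refine Finset.sum_congr rfl fun i hi => ?_
    rw [if_neg (Finset.mem_range.1 hi).ne]

theorem integral_mul_sum (h : IsOrthoSeq α W κ p) {s : Finset ℕ} (c : ℕ → ℝ)
    (hc : ∀ i ∉ s, c i = 0) (k : ℕ) :
    ∫ x in α..1, W.eval x * ((∑ i ∈ s, c i • p i).eval x * (p k).eval x) = κ * c k := by
  have e : ∀ x, W.eval x * ((∑ i ∈ s, c i • p i).eval x * (p k).eval x) =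
      ∑ i ∈ s, c i * (W.eval x * ((p i).eval x * (p k).eval x)) := by
    intro x
    rw [eval_finsetSum, Finset.sum_mul, Finset.mul_sum]
    refine Finset.sum_congr rfl fun i _ => ?_
    rw [eval_smul, smul_eq_mul]; ring
  simp_rw [e]
  rw [intervalIntegral.integral_finsetSum
        fun i _ => ((by fun_prop : Continuous _).intervalIntegrable _ _)]
  simp_rw [intervalIntegral.integral_const_mul, h.integral_mul]
  simp only [mul_ite, mul_zero, Finset.sum_ite_eq']
  split_ifs with hk
  · ring
  · rw [hc k hk, mul_zero]

/-- The matrix of `T` in the sequence `p`. -/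
def IsMatrixOf (p : ℕ → ℝ[X]) (T : ℝ[X] → ℝ[X]) (D : Matrix ℕ ℕ ℝ) : Prop :=
  (∀ k, {i | D i k ≠ 0}.Finite) ∧ ∀ k, T (p k) = ∑ᶠ i, D i k • p i

theorem finsum_smul_eq_sum {D : Matrix ℕ ℕ ℝ} {k : ℕ} (hD : {i | D i k ≠ 0}.Finite) :
    ∑ᶠ i, D i k • p i = ∑ i ∈ hD.toFinset, D i k • p i := by
  refine finsum_eq_sum_of_support_subset _ fun i hi => ?_
  simp only [Set.Finite.coe_toFinset, Set.mem_ofPred_eq]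
  intro h0
  simp [h0] at hi

/-- Orthogonality recovers each entry as a weighted integral; both the uniqueness of `D` and its
link to the energy come from this. -/
theorem integral_of_isMatrixOf (h : IsOrthoSeq α W κ p) {T : ℝ[X] → ℝ[X]} {D : Matrix ℕ ℕ ℝ}
    (hD : IsMatrixOf p T D) (i k : ℕ) :
    ∫ x in α..1, W.eval x * ((T (p k)).eval x * (p i).eval x) = κ * D i k := by
  rw [hD.2 k, finsum_smul_eq_sum (hD.1 k)]
  exact h.integral_mul_sum (fun i => D i k) (by simp) i

theorem isMatrixOf_unique (h : IsOrthoSeq α W κ p) {T : ℝ[X] → ℝ[X]} {D D' : Matrix ℕ ℕ ℝ}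
    (hD : IsMatrixOf p T D) (hD' : IsMatrixOf p T D') : D = D' := by
  ext i k
  exact mul_left_cancel₀ h.ne_zero
    ((h.integral_of_isMatrixOf hD i k).symm.trans (h.integral_of_isMatrixOf hD' i k))

/-- An operator that raises degrees by at most `d` has a matrix with zero entries more than `d`
places below the diagonal. -/
theorem exists_isMatrixOf (h : IsOrthoSeq α W κ p) {T : ℝ[X] → ℝ[X]} {d : ℕ}
    (hT : ∀ k, (T (p k)).degree < (k + d + 1 : ℕ)) :
    ∃ D, IsMatrixOf p T D ∧ ∀ i k, k + d < i → D i k = 0 := by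
  choose c hc using fun k => h.exists_sum _ _ (hT k)
  let D : Matrix ℕ ℕ ℝ := fun i k => if i ∈ Finset.range (k + d + 1) then c k i else 0
  have hfin : ∀ k, {i | D i k ≠ 0}.Finite := fun k =>
    (Finset.range (k + d + 1)).finite_toSet.subset fun i hi => by
      by_contra hcon
      exact hi (if_neg hcon)
  refine ⟨D, ⟨hfin, fun k => ?_⟩, fun i k hik => if_neg (by simpa using hik)⟩
  rw [finsum_eq_sum_of_support_subset (s := Finset.range (k + d + 1))]
  · exact (hc k).trans (Finset.sum_congr rfl fun i hi => by simp only [D, if_pos hi])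
  · intro i hi
    by_contra hcon
    refine hi ?_
    simp only [D]
    rw [if_neg (by simpa using hcon), zero_smul]

end IsOrthoSeq

/-! ### The radial Laplacian of bubbles in an orthogonal sequence -/

theorem degree_radialLaplacian_lt (m n : ℕ) {q : ℝ[X]} (hq : q.degree < (n + 1 : ℕ)) :
    (radialLaplacian m q).degree < n := by
  rw [degree_lt_iff_coeff_zero] at hq ⊢
  intro i hi
  have h1 := hq (i + 1) (by omega)
  rw [radialLaplacian, coeff_C_mul, coeff_add, coeff_C_mul, coeff_derivative, h1]
  rcases i with _ | i
  · simp
  · rw [coeff_X_mul, coeff_derivative, coeff_derivative, h1]; simp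

theorem degree_comp_of_degree_one {p l : ℝ[X]} (hl : l.degree = 1) (i : ℕ) (hp : p.degree = i) :
    (p.comp l).degree = i := by
  have hp0 : p ≠ 0 := by rintro rfl; simp at hp
  have hl1 : l.natDegree = 1 := natDegree_eq_of_degree_eq_some hl
  have h0 : p.comp l ≠ 0 := by
    rw [Ne, comp_eq_zero_iff]
    rintro (h | ⟨_, h⟩)
    · exact hp0 h
    · rw [h, natDegree_C] at hl1; omega
  rw [degree_eq_natDegree h0, natDegree_comp, hl1, mul_one, natDegree_eq_of_degree_eq_some hp]

namespace IsOrthoSeq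

variable {α κ : ℝ} {m d : ℕ} {β : ℝ[X]} {p : ℕ → ℝ[X]}

theorem radialEnergy_eq (h : IsOrthoSeq α (X ^ m * β) κ p) (h1 : β.eval 1 = 0)
    (hα : α = 0 ∨ β.eval α = 0) {D : Matrix ℕ ℕ ℝ}
    (hD : IsMatrixOf p (fun q => radialLaplacian m (β * q)) D) (i k : ℕ) :
    radialEnergy α m (β * p i) (β * p k) = -(fourierPi m / 2) * (κ * D i k) := by
  rw [radialEnergy_comm, radialEnergy_eq_neg_integral α m _ _ (by simp [h1])
    (hα.imp_right fun h' => by simp [h']), ← h.integral_of_isMatrixOf hD i k]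
  congr 1
  refine intervalIntegral.integral_congr fun s _ => ?_
  simp only [eval_mul, eval_pow, eval_X]
  ring

theorem matrix_symm (h : IsOrthoSeq α (X ^ m * β) κ p) (h1 : β.eval 1 = 0)
    (hα : α = 0 ∨ β.eval α = 0) {D : Matrix ℕ ℕ ℝ}
    (hD : IsMatrixOf p (fun q => radialLaplacian m (β * q)) D) (i k : ℕ) : D i k = D k i := by
  have e := (h.radialEnergy_eq h1 hα hD i k).symm.trans
    ((radialEnergy_comm _ _ _ _).trans (h.radialEnergy_eq h1 hα hD k i))
  have hπ : -(fourierPi m / 2) ≠ 0 := by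
    unfold fourierPi
    split_ifs <;> simp [Real.pi_ne_zero]
  exact mul_left_cancel₀ h.ne_zero (mul_left_cancel₀ hπ e)

/-- The product `β * p k` has degree `k + d + 1` and the radial Laplacian lowers it to at most `k +
d`, which bounds the band below the diagonal; symmetry of the energy bounds it above. -/
theorem existsUnique_banded (h : IsOrthoSeq α (X ^ m * β) κ p) (h1 : β.eval 1 = 0)
    (hα : α = 0 ∨ β.eval α = 0) (hβ : β.degree = (d + 1 : ℕ)) :
    ∃ D, (IsMatrixOf p (fun q => radialLaplacian m (β * q)) D ∧
      ∀ D', IsMatrixOf p (fun q => radialLaplacian m (β * q)) D' → D' = D) ∧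
      ∀ i k, i + d < k ∨ k + d < i → D i k = 0 := by
  obtain ⟨D, hD, hband⟩ := h.exists_isMatrixOf (T := fun q => radialLaplacian m (β * q)) (d := d)
    fun k => degree_radialLaplacian_lt m _ (by
      rw [degree_mul, hβ, h.degree_eq, ← Nat.cast_add]
      exact WithBot.coe_lt_coe.2 (by simp only [Nat.cast_id]; omega))
  refine ⟨D, ⟨hD, fun D' hD' => h.isMatrixOf_unique hD' hD⟩, ?_⟩
  rintro i k (hik | hik)
  · rw [h.matrix_symm h1 hα hD, hband _ _ hik]
  · exact hband _ _ hik

/-- The constant `a` equals `(a / b) p 0`, so orthogonality leaves only `k = 0`. This gives the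
hat-bubble entries of the annulus. -/
theorem radialEnergy_of_radialLaplacian_eq_C (h : IsOrthoSeq α (X ^ m * β) κ p)
    (h1 : β.eval 1 = 0) (hα : α = 0 ∨ β.eval α = 0) {q : ℝ[X]} {a b : ℝ}
    (hq : radialLaplacian m q = C a) (hp : p 0 = C b) (k : ℕ) :
    radialEnergy α m q (β * p k) = if k = 0 then -(fourierPi m / 2) * (a * (κ / b)) else 0 := by
  have hb : b ≠ 0 := by
    rintro rfl
    have := h.degree_eq 0
    simp [hp] at this
  have hint := h.integral_mul 0 k
  rw [radialEnergy_eq_neg_integral α m _ _ (by simp [h1])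
    (hα.imp_right fun h' => by simp [h']), hq]
  have e : ∫ s in α..1, s ^ m * ((C a).eval s * (β * p k).eval s) =
      a / b * ∫ s in α..1, (X ^ m * β).eval s * ((p 0).eval s * (p k).eval s) := by
    rw [← intervalIntegral.integral_const_mul]
    refine intervalIntegral.integral_congr fun s _ => ?_
    simp only [hp, eval_mul, eval_pow, eval_X, eval_C]
    field_simp
  rw [e, hint]
  by_cases hk : k = 0
  · subst hk; simp only [if_true]; field_simp
  · rw [if_neg (Ne.symm hk), if_neg hk, mul_zero, mul_zero]

end IsOrthoSeq

theorem modeFun_finsum (m : ℕ) (j : Fin 2) {p : ℕ → ℝ[X]} {D : Matrix ℕ ℕ ℝ} {k : ℕ}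
    (hD : {i | D i k ≠ 0}.Finite) (z : ℂ) :
    ∑ᶠ i, modeFun m j (p i) z * D i k = modeFun m j (∑ᶠ i, D i k • p i) z := by
  rw [IsOrthoSeq.finsum_smul_eq_sum hD, finsum_eq_sum_of_support_subset (s := hD.toFinset)]
  · rw [modeFun, eval_finsetSum, Finset.mul_sum]
    refine Finset.sum_congr rfl fun i _ => ?_
    rw [modeFun, eval_smul, smul_eq_mul]
    ring
  · intro i hi
    simp only [Set.Finite.coe_toFinset, Set.mem_ofPred_eq]
    intro h0
    simp [h0] at hi

/-- On the positive real axis `Y_{m,1} = r^m` is nonzero, so `q` and `p` agree at infinitely many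
points `r²`. The sign `j = 1` is admissible for every `m`. -/
theorem modeFun_injOn (m : ℕ) {Ω : Set ℂ} {a : ℝ} (ha : 0 ≤ a) (ha1 : a < 1)
    (hΩ : ∀ r ∈ Set.Ioo a 1, (r : ℂ) ∈ Ω) {q p : ℝ[X]}
    (h : ∀ z ∈ Ω, modeFun m 1 q z = modeFun m 1 p z) : q = p := by
  have hinj : Set.InjOn (fun r : ℝ => r ^ 2) (Set.Ioo a 1) := fun x hx y hy hxy =>
    (pow_left_inj₀ (ha.trans hx.1.le) (ha.trans hy.1.le) two_ne_zero).1 hxy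
  refine eq_of_infinite_eval_eq q p
    (((Set.Ioo_infinite ha1).image hinj).mono ?_)
  rintro _ ⟨r, hr, rfl⟩
  have hr0 : 0 < r := ha.trans_lt hr.1
  have := h r (hΩ r hr)
  simp only [modeFun, harmonicY_eq, if_true, Complex.norm_real, Real.norm_eq_abs, sq_abs,
    ← Complex.ofReal_pow, Complex.ofReal_re] at this
  exact mul_left_cancel₀ (pow_pos hr0 m).ne' this

theorem isMatrixOf_radialLaplacian_iff (m : ℕ) {Ω : Set ℂ} {a : ℝ} (ha : 0 ≤ a) (ha1 : a < 1)
    (hΩ : ∀ r ∈ Set.Ioo a 1, (r : ℂ) ∈ Ω) (β : ℝ[X]) (p : ℕ → ℝ[X]) (D : Matrix ℕ ℕ ℝ) :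
    ((∀ k, {i | D i k ≠ 0}.Finite) ∧ ∀ j, IsFourierMode m j → ∀ k, ∀ z ∈ Ω,
      Laplacian.laplacian (modeFun m j (β * p k)) z = ∑ᶠ i, modeFun m j (p i) z * D i k) ↔
    IsOrthoSeq.IsMatrixOf p (fun q => radialLaplacian m (β * q)) D := by
  refine and_congr_right fun hD => ⟨fun h k => ?_, fun h j _ k z _ => ?_⟩
  · refine modeFun_injOn m ha ha1 hΩ fun z hz => ?_
    rw [← modeFun_finsum m 1 (hD k), ← h 1 (fun _ => rfl) k z hz, laplacian_modeFun]
  · rw [modeFun_finsum m j (hD k), laplacian_modeFun]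
    exact congrArg (fun q => modeFun m j q z) (h k)

/-! ### Stiffness matrices of families of Fourier modes -/

section Stiffness

variable {Ω : Set ℂ} {α : ℝ}

theorem stiffnessMatrix_modeFun
    (hΩ : ∀ {m m' : ℕ} {j j' : Fin 2}, IsFourierMode m j → ∀ q p : ℝ[X],
      ∫ z in Ω, inner ℝ (gradient (modeFun m j q) z) (gradient (modeFun m' j' p) z) =
        if (m, j) = (m', j') then radialEnergy α m q p else 0)
    {m : ℕ} {j : Fin 2} (hj : IsFourierMode m j) (P : ℕ → ℝ[X]) (i k : ℕ) :
    stiffnessMatrix Ω (fun i => modeFun m j (P i)) i k = radialEnergy α m (P i) (P k) := by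
  rw [stiffnessMatrix, Matrix.of_apply, hΩ hj, if_pos rfl]

theorem stiffnessMatrix_fullFamily
    (hΩ : ∀ {m m' : ℕ} {j j' : Fin 2}, IsFourierMode m j → ∀ q p : ℝ[X],
      ∫ z in Ω, inner ℝ (gradient (modeFun m j q) z) (gradient (modeFun m' j' p) z) =
        if (m, j) = (m', j') then radialEnergy α m q p else 0)
    (P : ℕ → ℕ → ℝ[X]) :
    stiffnessMatrix Ω (fun p : ℕ × FourierMode => modeFun p.2.1.1 p.2.1.2 (P p.2.1.1 p.1)) =
      Matrix.blockDiagonal (fun p : FourierMode =>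
        stiffnessMatrix Ω (fun i => modeFun p.1.1 p.1.2 (P p.1.1 i))) := by
  ext ⟨i, p⟩ ⟨k, p'⟩
  rw [Matrix.blockDiagonal_apply]
  split_ifs with h
  · subst h; rfl
  · have h' : ¬ (p.1.1, p.1.2) = (p'.1.1, p'.1.2) := fun e => h (Subtype.ext e)
    rw [stiffnessMatrix, Matrix.of_apply, hΩ p.2, if_neg h']

end Stiffness

/-! ### The disk -/

theorem jacobiWeight_one (m : ℕ) : jacobiWeight 1 m = fun x => (1 - x) * (1 + x) ^ m := by
  funext x
  simp [jacobiWeight]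

theorem jacobiNorm_zero_nonneg (m : ℕ) : 0 ≤ jacobiNorm 0 m := by
  refine intervalIntegral.integral_nonneg (by norm_num) fun x hx => ?_
  have : 0 ≤ 1 + x := by linarith [hx.1]
  simp only [jacobiWeight, Real.rpow_zero, one_mul, Real.rpow_natCast]
  positivity

/-- The radial factor of `Z^{(1)}_{m+2i,m,j}`, as a polynomial in `r²`. -/
def diskPoly (m i : ℕ) : ℝ[X] := (jacobiP 1 m i).comp (C 2 * X + C (-1))

/-- The radial factors of the basis of the disk, as polynomials in `r²`. -/
def diskBasisPoly (m : ℕ) : ℕ → ℝ[X]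
  | 0 => C (Real.sqrt (jacobiNorm 0 m))⁻¹
  | k + 1 => (1 - X) * diskPoly m k

/-- Under `x = 2s - 1` the Jacobi weight becomes `2^(m+1) s^m (1 - s)`, and `dx = 2 ds` supplies one
more factor `2`. -/
theorem isOrthoSeq_diskPoly (m : ℕ) :
    IsOrthoSeq 0 (X ^ m * (1 - X)) (2 ^ (m + 2))⁻¹ (diskPoly m) := by
  have hw : Continuous (jacobiWeight 1 m) := by rw [jacobiWeight_one]; fun_prop
  have hpos : ∀ x ∈ Set.Ioo (-1 : ℝ) 1, 0 < jacobiWeight 1 m x := by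
    intro x hx
    rw [jacobiWeight_one]
    have h1 : 0 < 1 - x := by linarith [hx.2]
    have h2 : 0 < 1 + x := by linarith [hx.1]
    positivity
  refine ⟨fun i => degree_comp_of_degree_one (degree_linear two_ne_zero) i
    (degree_orthonormalPoly (by norm_num) hw hpos i), by positivity, fun i k => ?_⟩
  have h := integral_orthonormalPoly_mul (by norm_num) hw hpos i k
  have e : ∀ s : ℝ, (X ^ m * (1 - X) : ℝ[X]).eval s * ((diskPoly m i).eval s * (diskPoly m k).eval s) =
      (2 ^ (m + 1))⁻¹ * (fun x => (jacobiP 1 m i).eval x * (jacobiP 1 m k).eval x *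
        jacobiWeight 1 m x) (2 * s - 1) := by
    intro s
    simp only [diskPoly, jacobiWeight_one, eval_comp, eval_mul, eval_add, eval_sub, eval_pow,
      eval_X, eval_C, eval_one, ← sub_eq_add_neg]
    rw [show 1 + (2 * s - 1) = 2 * s by ring, mul_pow]
    field_simp
    ring
  simp_rw [e]
  rw [intervalIntegral.integral_const_mul,
    intervalIntegral.integral_comp_mul_sub (fun x => (jacobiP 1 m i).eval x *
      (jacobiP 1 m k).eval x * jacobiWeight 1 m x) two_ne_zero]
  norm_num
  unfold jacobiP
  rw [h]
  split_ifs
  · ring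
  · ring

theorem zernike_one_eq (m i : ℕ) (j : Fin 2) :
    zernike 1 (m + 2 * i) m j = modeFun m j (diskPoly m i) := by
  funext z
  rw [zernike, modeFun, diskPoly, eval_comp, Nat.add_sub_cancel_left,
    Nat.mul_div_cancel_left _ two_pos]
  simp [sub_eq_add_neg]

theorem diskBubble_eq (m i : ℕ) (j : Fin 2) :
    diskBubble (m + 2 * i) m j = modeFun m j ((1 - X) * diskPoly m i) := by
  funext z
  rw [diskBubble, zernike_one_eq]
  simp only [modeFun, eval_mul, eval_sub, eval_one, eval_X]
  ring

theorem diskBasis_eq (m : ℕ) (j : Fin 2) :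
    diskBasis m j = fun k => modeFun m j (diskBasisPoly m k) := by
  funext k
  rcases k with _ | k
  · funext z
    simp [diskBasis, zernike, modeFun, diskBasisPoly, jacobiP, orthonormalPoly_zero, jacobiNorm]
  · rw [diskBasis, diskBubble_eq, diskBasisPoly]

theorem isDiskLaplacianMatrix_iff (m : ℕ) (D : Matrix ℕ ℕ ℝ) :
    IsDiskLaplacianMatrix m D ↔
      IsOrthoSeq.IsMatrixOf (diskPoly m) (fun q => radialLaplacian m ((1 - X) * q)) D := by
  rw [← isMatrixOf_radialLaplacian_iff (Ω := unitDisk) m le_rfl one_pos]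
  · simp only [IsDiskLaplacianMatrix, diskBubble_eq, zernike_one_eq]
  · intro r hr
    simpa [unitDisk, abs_of_pos hr.1] using hr.2

theorem radialEnergy_diskBasisPoly {m : ℕ} {D : Matrix ℕ ℕ ℝ} (hD : IsDiskLaplacianMatrix m D)
    (i k : ℕ) : radialEnergy 0 m (diskBasisPoly m i) (diskBasisPoly m k) = diskBlock m D i k := by
  have h := isOrthoSeq_diskPoly m
  -- The disk hat is a multiple of `Y_{m,j}`, hence harmonic, so it is energy-orthogonal to all
  -- bubbles.
  have hhat (k : ℕ) :
      radialEnergy 0 m (diskBasisPoly m 0) (diskBasisPoly m (k + 1)) = 0 := by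
    rw [diskBasisPoly, diskBasisPoly, radialEnergy_eq_neg_integral _ _ _ _ (by simp) (Or.inl rfl)]
    simp [radialLaplacian]
  rcases i with _ | i <;> rcases k with _ | k
  · have hs : (Real.sqrt (jacobiNorm 0 m))⁻¹ * (Real.sqrt (jacobiNorm 0 m))⁻¹ =
        (jacobiNorm 0 m)⁻¹ := by
      rw [← mul_inv, Real.mul_self_sqrt (jacobiNorm_zero_nonneg m)]
    simp only [diskBlock, diskBasisPoly, radialEnergy, eval_C, derivative_C, eval_zero, hs]
    rcases m with _ | m
    · simp
    · simp [fourierPi]; ring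
  · exact hhat k
  · rw [radialEnergy_comm]; exact hhat i
  · rw [diskBasisPoly, diskBasisPoly, h.radialEnergy_eq (by simp) (Or.inl rfl)
      ((isDiskLaplacianMatrix_iff m D).1 hD), diskBlock]
    field_simp
    ring

/-! ### The annulus -/

section Annulus

variable {ρ : ℝ}

theorem annulusT_mul (hρ0 : 0 < ρ) (hρ1 : ρ < 1) : annulusT ρ * (1 - ρ ^ 2) = 1 :=
  inv_mul_cancel₀ (by nlinarith)

theorem one_lt_annulusT (hρ0 : 0 < ρ) (hρ1 : ρ < 1) : 1 < annulusT ρ :=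
  (one_lt_inv₀ (by nlinarith)).2 (by nlinarith)

theorem semiJacobiNorm_pos {t a b : ℝ} {m : ℕ} (ht : 1 < t) (hw : Continuous (semiJacobiWeight t a b m)) :
    0 < semiJacobiNorm t a b m := by
  have hpos : ∀ x ∈ Set.Ioo (0 : ℝ) 1, 0 < semiJacobiWeight t a b m x := by
    intro x hx
    have h1 : 0 < x := hx.1
    have h2 : 0 < 1 - x := by linarith [hx.2]
    have h3 : 0 < t - x := by linarith [hx.2]
    unfold semiJacobiWeight
    positivity
  simpa [semiJacobiNorm] using integral_sq_mul_weight_pos one_pos hw hpos one_ne_zero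

theorem continuous_semiJacobiWeight (t : ℝ) {a b : ℝ} (ha : 0 ≤ a) (hb : 0 ≤ b) (m : ℕ) :
    Continuous (semiJacobiWeight t a b m) := by
  unfold semiJacobiWeight
  simp only [Real.rpow_natCast]
  exact ((Real.continuous_rpow_const ha).mul
    ((Real.continuous_rpow_const hb).comp (by fun_prop))).mul (by fun_prop)

/-- The radial factor of `Z^{ρ,(1,1)}_{m+2i,m,j}`, as a polynomial in `r²`. -/
def annulusPoly (ρ : ℝ) (m i : ℕ) : ℝ[X] :=
  (semiJacobiQ (annulusT ρ) 1 1 m i).comp (C (-annulusT ρ) * X + C (annulusT ρ))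

/-- The radial factors of the basis of the annulus, as polynomials in `r²`. -/
def annulusBasisPoly (ρ : ℝ) (m : ℕ) : ℕ → ℝ[X]
  | 0 => C (Real.sqrt (semiJacobiNorm (annulusT ρ) 1 0 m))⁻¹ * (1 - X)
  | 1 => C (Real.sqrt (semiJacobiNorm (annulusT ρ) 0 1 m))⁻¹ * (X - C (ρ ^ 2))
  | k + 2 => (1 - X) * (X - C (ρ ^ 2)) * annulusPoly ρ m k

/-- Put `x = t (1 - s)`. As `t (1 - ρ²) = 1`, also `1 - x = t (s - ρ²)` and `t - x = t s`, so the
weight is `t^(m+2) s^m (1 - s)(s - ρ²)`; the substitution supplies one more `t`. -/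
theorem isOrthoSeq_annulusPoly (hρ0 : 0 < ρ) (hρ1 : ρ < 1) (m : ℕ) :
    IsOrthoSeq (ρ ^ 2) (X ^ m * ((1 - X) * (X - C (ρ ^ 2)))) (annulusT ρ ^ (m + 3))⁻¹
      (annulusPoly ρ m) := by
  have ht := one_lt_annulusT hρ0 hρ1
  have ht0 : annulusT ρ ≠ 0 := by positivity
  have htm := annulusT_mul hρ0 hρ1
  have hw := continuous_semiJacobiWeight (annulusT ρ) zero_le_one zero_le_one m
  have hpos : ∀ x ∈ Set.Ioo (0 : ℝ) 1, 0 < semiJacobiWeight (annulusT ρ) 1 1 m x := by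
    intro x hx
    have h1 : 0 < x := hx.1
    have h2 : 0 < 1 - x := by linarith [hx.2]
    have h3 : 0 < annulusT ρ - x := by linarith [hx.2]
    unfold semiJacobiWeight
    positivity
  have hsign : ∀ n : ℕ, ((-1 : ℝ) ^ n) * (-1) ^ n = 1 := fun n => by
    rw [← mul_pow]; norm_num
  refine ⟨fun i => degree_comp_of_degree_one (degree_linear (neg_ne_zero.2 ht0)) i ?_,
    by positivity, fun i k => ?_⟩
  · rw [semiJacobiQ, degree_C_mul (pow_ne_zero _ (by norm_num)),
      degree_orthonormalPoly one_pos hw hpos i]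
  have h := integral_orthonormalPoly_mul one_pos hw hpos i k
  have e : ∀ s : ℝ, (X ^ m * ((1 - X) * (X - C (ρ ^ 2))) : ℝ[X]).eval s *
      ((annulusPoly ρ m i).eval s * (annulusPoly ρ m k).eval s) =
      ((-1) ^ i * (-1) ^ k * (annulusT ρ ^ (m + 2))⁻¹) *
      (fun x => (orthonormalPoly 0 1 (semiJacobiWeight (annulusT ρ) 1 1 m) i).eval x *
        (orthonormalPoly 0 1 (semiJacobiWeight (annulusT ρ) 1 1 m) k).eval x *
        semiJacobiWeight (annulusT ρ) 1 1 m x) (annulusT ρ - annulusT ρ * s) := by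
    intro s
    have e1 : -annulusT ρ * s + annulusT ρ = annulusT ρ - annulusT ρ * s := by ring
    have e2 : 1 - (annulusT ρ - annulusT ρ * s) = annulusT ρ * (s - ρ ^ 2) := by
      linear_combination -htm
    have e3 : annulusT ρ - (annulusT ρ - annulusT ρ * s) = annulusT ρ * s := by ring
    simp only [annulusPoly, semiJacobiQ, semiJacobiWeight, eval_comp, eval_mul, eval_add, eval_sub,
      eval_pow, eval_X, eval_C, eval_one, e1, e2, e3, Real.rpow_one, Real.rpow_natCast, mul_pow]
    generalize annulusT ρ = t at ht0 ⊢
    field_simp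
    ring
  simp_rw [e]
  rw [intervalIntegral.integral_const_mul,
    intervalIntegral.integral_comp_sub_mul (fun x =>
      (orthonormalPoly 0 1 (semiJacobiWeight (annulusT ρ) 1 1 m) i).eval x *
        (orthonormalPoly 0 1 (semiJacobiWeight (annulusT ρ) 1 1 m) k).eval x *
        semiJacobiWeight (annulusT ρ) 1 1 m x) ht0, mul_one, sub_self,
    show annulusT ρ - annulusT ρ * ρ ^ 2 = 1 by linear_combination htm, h, smul_eq_mul]
  split_ifs with hik
  · subst hik
    rw [hsign]
    field_simp
    ring
  · ring

theorem zernikeAnnular_one_one_eq (ρ : ℝ) (m i : ℕ) (j : Fin 2) :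
    zernikeAnnular ρ 1 1 (m + 2 * i) m j = modeFun m j (annulusPoly ρ m i) := by
  funext z
  rw [zernikeAnnular, modeFun, annulusPoly, eval_comp, Nat.add_sub_cancel_left,
    Nat.mul_div_cancel_left _ two_pos]
  congr 2
  simp only [eval_add, eval_mul, eval_C, eval_X, annulusT]
  ring

theorem annulusBubble_eq (ρ : ℝ) (m i : ℕ) (j : Fin 2) :
    annulusBubble ρ (m + 2 * i) m j =
      modeFun m j ((1 - X) * (X - C (ρ ^ 2)) * annulusPoly ρ m i) := by
  funext z
  rw [annulusBubble, zernikeAnnular_one_one_eq]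
  simp only [modeFun, eval_mul, eval_sub, eval_one, eval_X, eval_C]
  ring

theorem zernikeAnnular_self (ρ a b : ℝ) (m : ℕ) (j : Fin 2) (z : ℂ) :
    zernikeAnnular ρ a b m m j z =
      harmonicY m j z * (Real.sqrt (semiJacobiNorm (annulusT ρ) a b m))⁻¹ := by
  simp [zernikeAnnular, semiJacobiQ, orthonormalPoly_zero, semiJacobiNorm]

theorem annulusBasis_eq (ρ : ℝ) (m : ℕ) (j : Fin 2) :
    annulusBasis ρ m j = fun k => modeFun m j (annulusBasisPoly ρ m k) := by
  funext k
  rcases k with _ | _ | k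
  · funext z
    simp [annulusBasis, zernikeAnnular_self, modeFun, annulusBasisPoly]
    ring
  · funext z
    simp [annulusBasis, zernikeAnnular_self, modeFun, annulusBasisPoly]
    ring
  · rw [annulusBasis, annulusBubble_eq, annulusBasisPoly]

theorem isAnnulusLaplacianMatrix_iff (hρ0 : 0 < ρ) (hρ1 : ρ < 1) (m : ℕ) (D : Matrix ℕ ℕ ℝ) :
    IsAnnulusLaplacianMatrix ρ m D ↔
      IsOrthoSeq.IsMatrixOf (annulusPoly ρ m)
        (fun q => radialLaplacian m ((1 - X) * (X - C (ρ ^ 2)) * q)) D := by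
  rw [← isMatrixOf_radialLaplacian_iff (Ω := annulus ρ) m hρ0.le hρ1]
  · simp only [IsAnnulusLaplacianMatrix, annulusBubble_eq, zernikeAnnular_one_one_eq]
  · intro r hr
    simpa [annulus, abs_of_pos (hρ0.trans hr.1)] using hr

theorem radialEnergy_linear (α : ℝ) (m : ℕ) (a b c d : ℝ) :
    radialEnergy α m (C a * X + C b) (C c * X + C d) =
      fourierPi m * (m * ((a + b) * (c + d) - α ^ m * ((a * α + b) * (c * α + d))) +
        2 * (a * c * ((1 - α ^ (m + 2)) / (m + 2)))) := by
  rw [radialEnergy]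
  simp only [derivative_add, derivative_mul, derivative_C, derivative_X, eval_add, eval_mul,
    eval_C, eval_X, zero_mul, mul_one, zero_add, add_zero]
  rw [intervalIntegral.integral_mul_const, integral_pow]
  push_cast
  rw [one_pow, show (m : ℝ) + 1 + 1 = m + 2 by ring, show m + 1 + 1 = m + 2 by ring]
  ring

theorem radialLaplacian_linear (m : ℕ) (a b : ℝ) :
    radialLaplacian m (C a * X + C b) = C (4 * (m + 1) * a) := by
  simp [radialLaplacian]
  ring

theorem radialEnergy_annulusBasisPoly (hρ0 : 0 < ρ) (hρ1 : ρ < 1) {m : ℕ} {D : Matrix ℕ ℕ ℝ}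
    (hD : IsAnnulusLaplacianMatrix ρ m D) (i k : ℕ) :
    radialEnergy (ρ ^ 2) m (annulusBasisPoly ρ m i) (annulusBasisPoly ρ m k) =
      annulusBlock ρ m D i k := by
  have h := isOrthoSeq_annulusPoly hρ0 hρ1 m
  have ht := one_lt_annulusT hρ0 hρ1
  have q10 := semiJacobiNorm_pos ht (continuous_semiJacobiWeight _ zero_le_one le_rfl m)
  have q01 := semiJacobiNorm_pos ht (continuous_semiJacobiWeight _ le_rfl zero_le_one m)
  have q11 := semiJacobiNorm_pos ht (continuous_semiJacobiWeight _ zero_le_one zero_le_one m)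
  have s10 := Real.sqrt_pos.2 q10
  have s01 := Real.sqrt_pos.2 q01
  have s11 := Real.sqrt_pos.2 q11
  have sq10 := Real.sq_sqrt q10.le
  have sq01 := Real.sq_sqrt q01.le
  have b1 : ((1 - X) * (X - C (ρ ^ 2)) : ℝ[X]).eval 1 = 0 := by simp
  have bα : ρ ^ 2 = 0 ∨ ((1 - X) * (X - C (ρ ^ 2)) : ℝ[X]).eval (ρ ^ 2) = 0 := Or.inr (by simp)
  have hp0 : annulusPoly ρ m 0 = C (Real.sqrt (semiJacobiNorm (annulusT ρ) 1 1 m))⁻¹ := by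
    simp [annulusPoly, semiJacobiQ, orthonormalPoly_zero, semiJacobiNorm]
  have l0 : annulusBasisPoly ρ m 0 = C (-(Real.sqrt (semiJacobiNorm (annulusT ρ) 1 0 m))⁻¹) * X +
      C (Real.sqrt (semiJacobiNorm (annulusT ρ) 1 0 m))⁻¹ := by
    rw [annulusBasisPoly, C_neg]; ring
  have l1 : annulusBasisPoly ρ m 1 = C (Real.sqrt (semiJacobiNorm (annulusT ρ) 0 1 m))⁻¹ * X +
      C (-((Real.sqrt (semiJacobiNorm (annulusT ρ) 0 1 m))⁻¹ * ρ ^ 2)) := by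
    rw [annulusBasisPoly, C_neg, C_mul]; ring
  have hT : annulusT ρ ^ 2 * (1 - ρ ^ 2) ^ 2 = 1 := by
    rw [← mul_pow, annulusT_mul hρ0 hρ1, one_pow]
  have E00 : radialEnergy (ρ ^ 2) m (annulusBasisPoly ρ m 0) (annulusBasisPoly ρ m 0) =
      coeffA ρ m := by
    rw [l0, radialEnergy_linear, coeffA]
    generalize Real.sqrt (semiJacobiNorm (annulusT ρ) 1 0 m) = s at s10 sq10 ⊢
    rw [← sq10]
    field_simp
    ring
  have E01 : radialEnergy (ρ ^ 2) m (annulusBasisPoly ρ m 0) (annulusBasisPoly ρ m 1) =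
      coeffB ρ m := by
    rw [l0, l1, radialEnergy_linear, coeffB]
    generalize Real.sqrt (semiJacobiNorm (annulusT ρ) 1 0 m) = s at s10 ⊢
    generalize Real.sqrt (semiJacobiNorm (annulusT ρ) 0 1 m) = s' at s01 ⊢
    field_simp
    ring
  have E11 : radialEnergy (ρ ^ 2) m (annulusBasisPoly ρ m 1) (annulusBasisPoly ρ m 1) =
      coeffC ρ m := by
    -- The term with `t⁻²` in `coeffC` is the boundary term at `s = 1`, where the hat's factor `s -
    -- ρ²` equals `1 - ρ² = t⁻¹`.
    have hT' : (m : ℝ) * (2 + m) / annulusT ρ ^ 2 = m * (2 + m) * (1 - ρ ^ 2) ^ 2 := by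
      rw [div_eq_iff (by positivity)]
      linear_combination (-(m : ℝ) * (2 + m)) * hT
    rw [l1, radialEnergy_linear, coeffC, hT']
    generalize Real.sqrt (semiJacobiNorm (annulusT ρ) 0 1 m) = s at s01 sq01 ⊢
    rw [← sq01]
    field_simp
    ring
  have E0 (k : ℕ) : radialEnergy (ρ ^ 2) m (annulusBasisPoly ρ m 0) (annulusBasisPoly ρ m (k + 2)) =
      if k = 0 then coeffD ρ m else 0 := by
    rw [l0, annulusBasisPoly,
      h.radialEnergy_of_radialLaplacian_eq_C b1 bα (radialLaplacian_linear _ _ _) hp0 k, coeffD]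
    congr 1
    field_simp
    ring
  have E1 (k : ℕ) : radialEnergy (ρ ^ 2) m (annulusBasisPoly ρ m 1) (annulusBasisPoly ρ m (k + 2)) =
      if k = 0 then coeffE ρ m else 0 := by
    rw [l1, annulusBasisPoly,
      h.radialEnergy_of_radialLaplacian_eq_C b1 bα (radialLaplacian_linear _ _ _) hp0 k, coeffE]
    congr 1
    field_simp
    ring
  rcases i with _ | _ | i <;> rcases k with _ | _ | k
  · exact E00
  · exact E01
  · rcases k with _ | k
    · exact E0 0
    · exact E0 (k + 1)
  · exact (radialEnergy_comm _ _ _ _).trans E01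
  · exact E11
  · rcases k with _ | k
    · exact E1 0
    · exact E1 (k + 1)
  · rw [radialEnergy_comm]
    rcases i with _ | i
    · exact E0 0
    · exact E0 (i + 1)
  · rw [radialEnergy_comm]
    rcases i with _ | i
    · exact E1 0
    · exact E1 (i + 1)
  · rw [annulusBasisPoly, annulusBasisPoly, h.radialEnergy_eq b1 bα
      ((isAnnulusLaplacianMatrix_iff hρ0 hρ1 m D).1 hD), annulusBlock]
    field_simp

end Annulus

/-! ### Assembly for the disk and the annulus -/

theorem degree_one_sub_X : (1 - X : ℝ[X]).degree = 1 := by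
  rw [← neg_sub, degree_neg, ← C_1, degree_X_sub_C]

end

theorem mainTheorem2 (ρ : ℝ) (hρ0 : 0 < ρ) (hρ1 : ρ < 1) :
    -- the disk
    (StiffnessIntegrable unitDisk diskFullBasis ∧
      stiffnessMatrix unitDisk diskFullBasis =
        Matrix.blockDiagonal
          (fun p : FourierMode => stiffnessMatrix unitDisk (diskBasis p.1.1 p.1.2)) ∧
      (∀ m : ℕ, (∃! D : Matrix ℕ ℕ ℝ, IsDiskLaplacianMatrix m D) ∧
        ∀ D : Matrix ℕ ℕ ℝ, IsDiskLaplacianMatrix m D →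
          D.IsDiag ∧
          ∀ j : Fin 2, IsFourierMode m j →
            stiffnessMatrix unitDisk (diskBasis m j) = diskBlock m D) ∧
      ∀ m : ℕ, 1 ≤ m →
        stiffnessMatrix unitDisk (diskBasis m 0) = stiffnessMatrix unitDisk (diskBasis m 1)) ∧
    -- the annulus
    (StiffnessIntegrable (annulus ρ) (annulusFullBasis ρ) ∧
      stiffnessMatrix (annulus ρ) (annulusFullBasis ρ) =
        Matrix.blockDiagonal
          (fun p : FourierMode => stiffnessMatrix (annulus ρ) (annulusBasis ρ p.1.1 p.1.2)) ∧
      (∀ m : ℕ, (∃! D : Matrix ℕ ℕ ℝ, IsAnnulusLaplacianMatrix ρ m D) ∧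
        ∀ D : Matrix ℕ ℕ ℝ, IsAnnulusLaplacianMatrix ρ m D →
          IsTridiagonal D ∧
          ∀ j : Fin 2, IsFourierMode m j →
            stiffnessMatrix (annulus ρ) (annulusBasis ρ m j) = annulusBlock ρ m D) ∧
      ∀ m : ℕ, 1 ≤ m →
        stiffnessMatrix (annulus ρ) (annulusBasis ρ m 0) =
          stiffnessMatrix (annulus ρ) (annulusBasis ρ m 1)) := by
  have hdisk := @setIntegral_unitDisk_inner_gradient
  have hann := @setIntegral_annulus_inner_gradient ρ hρ0.le hρ1
  have sdisk (m : ℕ) (j : Fin 2) (hj : IsFourierMode m j) (i k : ℕ) :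
      stiffnessMatrix unitDisk (diskBasis m j) i k =
        radialEnergy 0 m (diskBasisPoly m i) (diskBasisPoly m k) := by
    rw [diskBasis_eq]
    exact stiffnessMatrix_modeFun hdisk hj _ i k
  have sann (m : ℕ) (j : Fin 2) (hj : IsFourierMode m j) (i k : ℕ) :
      stiffnessMatrix (annulus ρ) (annulusBasis ρ m j) i k =
        radialEnergy (ρ ^ 2) m (annulusBasisPoly ρ m i) (annulusBasisPoly ρ m k) := by
    rw [annulusBasis_eq]
    exact stiffnessMatrix_modeFun hann hj _ i k
  have hmode {m : ℕ} (hm : 1 ≤ m) (j : Fin 2) : IsFourierMode m j := fun h => by omega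
  have fdisk : diskFullBasis = fun p : ℕ × FourierMode =>
      modeFun p.2.1.1 p.2.1.2 (diskBasisPoly p.2.1.1 p.1) := by
    funext p
    rw [diskFullBasis, diskBasis_eq]
  have fann : annulusFullBasis ρ = fun p : ℕ × FourierMode =>
      modeFun p.2.1.1 p.2.1.2 (annulusBasisPoly ρ p.2.1.1 p.1) := by
    funext p
    rw [annulusFullBasis, annulusBasis_eq]
  refine ⟨⟨?_, ?_, fun m => ?_, fun m hm => ?_⟩, ?_, ?_, fun m => ?_, fun m hm => ?_⟩
  · rw [fdisk]
    exact fun p q => integrableOn_inner_gradient subset_rfl _ _ _ _ _ _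
  · rw [fdisk, stiffnessMatrix_fullFamily hdisk]
    simp only [diskBasis_eq]
  -- The half-bandwidth `d` is `deg β - 1`: here `β = 1 - X` gives `0`; for the annulus `β` is
  -- quadratic and `d = 1`.
  · obtain ⟨D, ⟨hD, huniq⟩, hband⟩ := (isOrthoSeq_diskPoly m).existsUnique_banded (d := 0)
      (by simp) (Or.inl rfl) (by simpa using degree_one_sub_X)
    simp only [← isDiskLaplacianMatrix_iff] at hD huniq
    refine ⟨⟨D, hD, huniq⟩, fun D' hD' => ⟨fun i k hik => ?_, fun j hj => ?_⟩⟩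
    · rw [huniq D' hD']
      exact hband i k (by simpa using lt_or_gt_of_ne hik)
    · ext i k
      rw [sdisk m j hj, radialEnergy_diskBasisPoly hD']
  · ext i k
    rw [sdisk m 0 (hmode hm 0), sdisk m 1 (hmode hm 1)]
  · rw [fann]
    exact fun p q => integrableOn_inner_gradient (annulus_subset_unitDisk ρ) _ _ _ _ _ _
  · rw [fann, stiffnessMatrix_fullFamily hann]
    simp only [annulusBasis_eq]
  · obtain ⟨D, ⟨hD, huniq⟩, hband⟩ := (isOrthoSeq_annulusPoly hρ0 hρ1 m).existsUnique_banded
      (d := 1) (by simp) (Or.inr (by simp))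
      (by rw [Polynomial.degree_mul, degree_one_sub_X, Polynomial.degree_X_sub_C]; rfl)
    simp only [← isAnnulusLaplacianMatrix_iff hρ0 hρ1] at hD huniq
    refine ⟨⟨D, hD, huniq⟩, fun D' hD' => ⟨fun i k hik => ?_, fun j hj => ?_⟩⟩
    · rw [huniq D' hD']
      exact hband i k hik
    · ext i k
      rw [sann m j hj, radialEnergy_annulusBasisPoly hρ0 hρ1 hD']
  · ext i k
    rw [sann m 0 (hmode hm 0), sann m 1 (hmode hm 1)]
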